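/- Let $F$ be an algebraically closed field of characteristic $p>3$ and let $n\ge 2$. Let $\mathfrak g=\mathfrak p(n)$ be the Lie superalgebra over $F$ of all block matrices $\begin{pmatrix} a& b\\ c&-a^t\end{pmatrix}$ with $a,b,c\in M_n(F)$, $b$ symmetric and $c$ skew-symmetric, with the supercommutator as bracket; $\mathfrak g_{\bar 0}$ is given by $b=c=0$, $\mathfrak g_{\bar 1}$ by $a=0$, and $\mathfrak g_1$ by $a=c=0$. It is restricted, with $x^{[p]}$ the $p$-th matrix power for $x\in\mathfrak g_{\bar 0}$. Let $u(\mathfrak g)$ be its restricted enveloping superalgebra, let $d=\tfrac12 n(n-1)$, let $I$ be the two-sided ideal of $u(\mathfrak g)$ generated by all products of $k$ elements of $\mathfrak g_1$ with $k>d$, and let $\bar{\mathfrak u}=u(\mathfrak g)/I$. The group $G=GL_n(F)$ acts on $\mathfrak g$ by $x\mapsto\rho(g)x\rho(g)^{-1}$, $\rho(g)=\mathrm{diag}(g,(g^{-1})^{t})$, and hence on $\bar{\mathfrak u}$ by algebra automorphisms. Let $T\subset G$ be the torus of diagonal matrices, $\bar{\mathfrak u}^T$ the space of $T$-invariants, and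 $$\mathcal Z=\{u\in\bar{\mathfrak u}_{\bar 0}\mid gu=u \text{ for all } g\in G,\ [u,\mathfrak g_1]=0\}\subseteq\bar{\mathfrak u}^T .$$ Let $\mathfrak h\subset\mathfrak g_{\bar 0}$ be the diagonal matrices, with basis $h_i=e_{ii}-e_{n+i,n+i}$ and dual basis $\epsilon_i$ of $\mathfrak h^*$ ($1\le i\le n$), and let $u(\mathfrak h)=U(\mathfrak h)/(x^p-x^{[p]}: x\in\mathfrak h)$ be its restricted enveloping algebra. Let $\mathfrak n^+$ be the span of $\mathfrak g_1$ and of the $e_{ij}-e_{n+j,n+i}$ with $1\le i<j\le n$, let $\bar{\mathfrak u}\mathfrak n^+$ be the left ideal of $\bar{\mathfrak u}$ generated by $\mathfrak n^+$, and let $\mathfrak l=\bar{\mathfrak u}\mathfrak n^+\cap\bar{\mathfrak u}^T$. The Harish-Chandra map is the $F$-linear map $h:\bar{\mathfrak u}^T\to u(\mathfrak h)$ that has kernel $\mathfrak l$ and restricts to the identity on $u(\mathfrak h)$ (that is, composed with the canonical map $u(\mathfrak h)\to\bar{\mathfrak u}^T$ it gives the identity of $u(\mathfrak h)$). Let $W=S_n$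 be the Weyl group, acting on $\mathfrak h^*$ by $w\epsilon_i=\epsilon_{w(i)}$, let $\rho\in\mathfrak h^*$ satisfy $\rho(h_i-h_{i+1})=1$ for $1\le i<n$, and let $w\cdot\lambda=w(\lambda+\rho)-\rho$ be the dot action on $\mathfrak h^*$. It induces the dot action on $U(\mathfrak h)$, viewed as the algebra of polynomial functions on $\mathfrak h^*$, by $(w\cdot f)(\lambda)=f(w^{-1}\cdot\lambda)$, and this descends to $u(\mathfrak h)$. Let $u(\mathfrak h)^{W\cdot}$ be the set of invariants. Then the map $h$ exists and is unique, and $$h(\mathcal Z)\subseteq u(\mathfrak h)^{W\cdot}.$$ -/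

import Mathlib

open Matrix


noncomputable section

namespace Periplectic

/-! ### The Lie superalgebra p(n) -/

/-- Square matrices of size 2n, written in n × n blocks. -/
abbrev Mat (n : ℕ) (F : Type*) := Matrix (Fin n ⊕ Fin n) (Fin n ⊕ Fin n) F

section LieSuper

variable (n : ℕ) (F : Type*) [Field F]

/-- The space underlying p(n): all block matrices (a, b; c, -aᵗ) with b symmetric and
c skew-symmetric. -/
def pn : Submodule F (Mat n F) where
  carrier := {x | ∃ a b c : Matrix (Fin n) (Fin n) F,
    bᵀ = b ∧ cᵀ = -c ∧ x = fromBlocks a b c (-aᵀ)}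
  zero_mem' := ⟨0, 0, 0, by simp, by simp, by simp⟩
  add_mem' := by
    rintro _ _ ⟨a, b, c, hb, hc, rfl⟩ ⟨a', b', c', hb', hc', rfl⟩
    refine ⟨a + a', b + b', c + c', by simp [hb, hb'], by simp [hc, hc', add_comm], ?_⟩
    simp [fromBlocks_add, add_comm]
  smul_mem' := by
    rintro r _ ⟨a, b, c, hb, hc, rfl⟩
    exact ⟨r • a, r • b, r • c, by simp [hb], by simp [hc], by simp [fromBlocks_smul]⟩

variable {n F}

/-- The ℤ/2-grading of p(n): degree 0 consists of the elements with b = c = 0 and degree 1 of the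
elements with a = 0. -/
def HasParity (i : ZMod 2) (x : pn n F) : Prop :=
  if i = 0 then (x : Mat n F).toBlocks₁₂ = 0 ∧ (x : Mat n F).toBlocks₂₁ = 0
  else (x : Mat n F).toBlocks₁₁ = 0

/-- The component of ℤ-degree 1, where a = c = 0. -/
def IsDegOne (x : pn n F) : Prop :=
  (x : Mat n F).toBlocks₁₁ = 0 ∧ (x : Mat n F).toBlocks₂₁ = 0

/-- The nilradical spanned by the root vectors of the roots εᵢ - εⱼ, i < j, of the even part:
b = c = 0 and a is strictly upper triangular. -/
def IsEvenPos (x : pn n F) : Prop :=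
  HasParity 0 x ∧ ∀ i j : Fin n, j ≤ i → (x : Mat n F).toBlocks₁₁ i j = 0

/-- The off-diagonal (odd) part of a block matrix. -/
def oddPart (x : Mat n F) : Mat n F := fromBlocks 0 x.toBlocks₁₂ x.toBlocks₂₁ 0

/-- The supercommutator of block matrices: the bilinear map which is
xy - (-1)^(|x||y|) yx on homogeneous x, y. -/
def superComm (x y : Mat n F) : Mat n F :=
  x * y - y * x + (2 : F) • (oddPart y * oddPart x)

theorem superComm_mem {x y : Mat n F} (hx : x ∈ pn n F) (hy : y ∈ pn n F) :
    superComm x y ∈ pn n F := by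
  obtain ⟨a, b, c, hb, hc, rfl⟩ := hx
  obtain ⟨a', b', c', hb', hc', rfl⟩ := hy
  refine ⟨a * a' - a' * a + b * c' + b' * c, a * b' - b * a'ᵀ - a' * b + b' * aᵀ,
    c * a' - aᵀ * c' - c' * a + a'ᵀ * c, ?_, ?_, ?_⟩
  · simp [transpose_mul, hb, hb']; abel
  · simp [transpose_mul, hc, hc']; abel
  · simp only [superComm, oddPart, toBlocks_fromBlocks₁₂, toBlocks_fromBlocks₂₁,
      fromBlocks_multiply, sub_eq_add_neg, fromBlocks_neg, fromBlocks_add, fromBlocks_smul,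
      transpose_add, transpose_neg, transpose_mul, hb, hb', hc, hc']
    congr 1 <;> simp [two_smul] <;> abel

/-- The superbracket of p(n). -/
def bracket (x y : pn n F) : pn n F := ⟨superComm x.1 y.1, superComm_mem x.2 y.2⟩

/-- The sign (-1)^(ij). -/
def koszul (F : Type*) [Field F] (i j : ZMod 2) : F := if i = 1 ∧ j = 1 then -1 else 1

/-- On homogeneous elements the bracket is the supercommutator of matrices. -/
theorem bracket_coe {i j : ZMod 2} {x y : pn n F} (hx : HasParity i x) (hy : HasParity j y) :
    (bracket x y : Mat n F) = (x : Mat n F) * y - koszul F i j • ((y : Mat n F) * x) := by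
  obtain ⟨x, a, b, c, hb, hc, rfl⟩ := x
  obtain ⟨y, a', b', c', hb', hc', rfl⟩ := y
  have h2 : ∀ k : ZMod 2, k = 0 ∨ k = 1 := by decide
  rcases h2 i with rfl | rfl <;> rcases h2 j with rfl | rfl <;>
    simp_all [HasParity, bracket, superComm, oddPart, koszul, fromBlocks_multiply,
      sub_eq_add_neg, fromBlocks_neg, fromBlocks_add, two_smul]

theorem even_eq {x : pn n F} (hx : HasParity 0 x) :
    ∃ a : Matrix (Fin n) (Fin n) F, (x : Mat n F) = fromBlocks a 0 0 (-aᵀ) := by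
  obtain ⟨x, a, b, c, hb, hc, rfl⟩ := x
  simp only [HasParity, if_true, toBlocks_fromBlocks₁₂, toBlocks_fromBlocks₂₁] at hx
  exact ⟨a, by simp [hx.1, hx.2]⟩

theorem fromBlocks_diag_pow (a d : Matrix (Fin n) (Fin n) F) (k : ℕ) :
    (fromBlocks a 0 0 d : Mat n F) ^ k = fromBlocks (a ^ k) 0 0 (d ^ k) := by
  induction k with
  | zero => simp
  | succ k ih => simp [pow_succ, ih, fromBlocks_multiply]

variable (p : ℕ) [Fact p.Prime] [CharP F p]

theorem pow_mem {x : pn n F} (hx : HasParity 0 x) : (x : Mat n F) ^ p ∈ pn n F := by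
  obtain ⟨a, ha⟩ := even_eq hx
  refine ⟨a ^ p, 0, 0, by simp, by simp, ?_⟩
  rw [ha, fromBlocks_diag_pow]
  have h1 : ((-1 : F)) ^ p = -1 := neg_one_pow_char F p
  have h2 : (-aᵀ) = (-1 : F) • aᵀ := by simp
  rw [h2, smul_pow, h1, transpose_pow]
  simp

/-- The p-map of the even part: the p-th power of matrices. -/
def pMap (x : pn n F) (hx : HasParity 0 x) : pn n F := ⟨(x : Mat n F) ^ p, pow_mem p hx⟩

end LieSuper

/-! ### The restricted enveloping superalgebra and its quotient -/

section Enveloping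

variable (F : Type*) [Field F] (p : ℕ) [Fact p.Prime] [CharP F p] (n : ℕ)

/-- The defining relations of u(p(n)), inside the tensor algebra of p(n). -/
inductive URel : TensorAlgebra F (pn n F) → TensorAlgebra F (pn n F) → Prop
  | bracket (i j : ZMod 2) (x y : pn n F) (hx : HasParity i x) (hy : HasParity j y) :
      URel (TensorAlgebra.ι F x * TensorAlgebra.ι F y
          - koszul F i j • (TensorAlgebra.ι F y * TensorAlgebra.ι F x))
        (TensorAlgebra.ι F (bracket x y))
  | pPower (x : pn n F) (hx : HasParity 0 x) :
      URel (TensorAlgebra.ι F x ^ p) (TensorAlgebra.ι F (pMap p x hx))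

/-- The restricted enveloping superalgebra u(p(n)). -/
def U := RingQuot (URel F p n)

instance : Ring (U F p n) := inferInstanceAs (Ring (RingQuot (URel F p n)))
instance : Algebra F (U F p n) := inferInstanceAs (Algebra F (RingQuot (URel F p n)))

/-- The canonical map from p(n) to u(p(n)). -/
def ιU : pn n F →ₗ[F] U F p n :=
  (RingQuot.mkAlgHom F (URel F p n)).toLinearMap ∘ₗ TensorAlgebra.ι F

/-- The generators of the ideal I, that is, all products of k elements of degree 1
with k > n(n-1)/2, set equal to 0. -/
inductive IRel : U F p n → U F p n → Prop
  | mk (l : List (pn n F)) (hl : ∀ x ∈ l, IsDegOne x) (hk : n * (n - 1) / 2 < l.length) :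
      IRel (l.map (ιU F p n)).prod 0

/-- The quotient algebra ū = u(p(n)) / I. -/
def Ubar := RingQuot (IRel F p n)

instance : Ring (Ubar F p n) := inferInstanceAs (Ring (RingQuot (IRel F p n)))
instance : Algebra F (Ubar F p n) := inferInstanceAs (Algebra F (RingQuot (IRel F p n)))

/-- The projection of u(p(n)) onto ū. -/
def toUbar : U F p n →ₐ[F] Ubar F p n := RingQuot.mkAlgHom F (IRel F p n)

/-- The canonical map from p(n) to ū. -/
def ι : pn n F →ₗ[F] Ubar F p n := (toUbar F p n).toLinearMap ∘ₗ ιU F p n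

/-- The even part of ū: the span of all products of homogeneous elements of p(n) whose parities
add up to 0. -/
def evenUbar : Submodule F (Ubar F p n) :=
  Submodule.span F {u | ∃ l : List (ZMod 2 × pn n F), (∀ a ∈ l, HasParity a.1 a.2) ∧
    (l.map Prod.fst).sum = 0 ∧ u = (l.map fun a => ι F p n a.2).prod}

variable {F p n}

theorem ιU_bracket {i j : ZMod 2} {x y : pn n F} (hx : HasParity i x) (hy : HasParity j y) :
    ιU F p n x * ιU F p n y - koszul F i j • (ιU F p n y * ιU F p n x)
      = ιU F p n (bracket x y) := by
  have h := RingQuot.mkAlgHom_rel F (URel.bracket (p := p) i j x y hx hy)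
  rw [map_sub, map_smul, map_mul, map_mul] at h
  exact h

theorem ιU_pPower {x : pn n F} (hx : HasParity 0 x) :
    ιU F p n x ^ p = ιU F p n (pMap p x hx) := by
  have h := RingQuot.mkAlgHom_rel F (URel.pPower (p := p) x hx)
  rw [map_pow] at h
  exact h

theorem toUbar_prod (l : List (pn n F)) (hl : ∀ x ∈ l, IsDegOne x)
    (hk : n * (n - 1) / 2 < l.length) : toUbar F p n (l.map (ιU F p n)).prod = 0 := by
  have h := RingQuot.mkAlgHom_rel F (IRel.mk (p := p) l hl hk)
  rw [map_zero] at h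
  exact h

end Enveloping

/-! ### The action of GL(n) -/

section GroupAction

variable {F : Type*} [Field F] {n : ℕ}

/-- The embedding g ↦ diag(g, g⁻¹ᵗ) of GL(n) into invertible matrices of size 2n. -/
def rho (g : GL (Fin n) F) : Mat n F :=
  fromBlocks (g : Matrix (Fin n) (Fin n) F) 0 0 (((g⁻¹ : GL (Fin n) F) : Matrix _ _ F)ᵀ)

theorem rho_mul_inv (g : GL (Fin n) F) : rho g * rho g⁻¹ = 1 := by
  simp only [rho, fromBlocks_multiply, ← transpose_mul, inv_inv, ← Units.val_mul]
  simp

theorem rho_inv_mul (g : GL (Fin n) F) : rho g⁻¹ * rho g = 1 := by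
  simpa using rho_mul_inv g⁻¹

/-- The blocks of the conjugate of a block matrix. -/
theorem conj_fromBlocks (g : GL (Fin n) F) (a b c d : Matrix (Fin n) (Fin n) F) :
    rho g * fromBlocks a b c d * rho g⁻¹ =
      fromBlocks (g.1 * a * (g⁻¹).1) (g.1 * b * g.1ᵀ)
        ((g⁻¹).1ᵀ * c * (g⁻¹).1) ((g⁻¹).1ᵀ * d * g.1ᵀ) := by
  simp [rho, fromBlocks_multiply, Matrix.mul_assoc]

theorem conj_mem (g : GL (Fin n) F) {x : Mat n F} (hx : x ∈ pn n F) :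
    rho g * x * rho g⁻¹ ∈ pn n F := by
  obtain ⟨a, b, c, hb, hc, rfl⟩ := hx
  rw [conj_fromBlocks]
  refine ⟨_, _, _, ?_, ?_, congrArg _ ?_⟩
  · simp [transpose_mul, hb, Matrix.mul_assoc]
  · simp [transpose_mul, hc, Matrix.mul_assoc]
  · simp [transpose_mul, Matrix.mul_assoc]

/-- The adjoint action x ↦ ρ(g) x ρ(g)⁻¹ of GL(n) on p(n). -/
def Ad (g : GL (Fin n) F) : pn n F →ₗ[F] pn n F where
  toFun x := ⟨rho g * x * rho g⁻¹, conj_mem g x.2⟩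
  map_add' x y := by ext1; simp [Matrix.mul_add, Matrix.add_mul]
  map_smul' r x := by ext1; simp

theorem Ad_blocks (g : GL (Fin n) F) (x : pn n F) :
    (Ad g x : Mat n F) =
      fromBlocks (g.1 * x.1.toBlocks₁₁ * (g⁻¹).1) (g.1 * x.1.toBlocks₁₂ * g.1ᵀ)
        ((g⁻¹).1ᵀ * x.1.toBlocks₂₁ * (g⁻¹).1) ((g⁻¹).1ᵀ * x.1.toBlocks₂₂ * g.1ᵀ) := by
  rw [← conj_fromBlocks, fromBlocks_toBlocks]; rfl

theorem Ad_parity (g : GL (Fin n) F) {i : ZMod 2} {x : pn n F} (hx : HasParity i x) :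
    HasParity i (Ad g x) := by
  unfold HasParity at hx ⊢
  rw [Ad_blocks]
  split_ifs at hx ⊢ <;> simp [hx]

theorem Ad_degOne (g : GL (Fin n) F) {x : pn n F} (hx : IsDegOne x) : IsDegOne (Ad g x) := by
  unfold IsDegOne at hx ⊢
  rw [Ad_blocks]
  simp [hx]

theorem Ad_mul_coe (g : GL (Fin n) F) (x y : Mat n F) :
    (rho g * x * rho g⁻¹) * (rho g * y * rho g⁻¹) = rho g * (x * y) * rho g⁻¹ := by
  calc _ = rho g * x * (rho g⁻¹ * rho g) * y * rho g⁻¹ := by simp only [Matrix.mul_assoc]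
    _ = _ := by rw [rho_inv_mul]; simp only [Matrix.mul_assoc, Matrix.mul_one]

theorem Ad_bracket (g : GL (Fin n) F) {i j : ZMod 2} {x y : pn n F} (hx : HasParity i x)
    (hy : HasParity j y) : Ad g (bracket x y) = bracket (Ad g x) (Ad g y) := by
  ext1
  rw [bracket_coe (Ad_parity g hx) (Ad_parity g hy)]
  change rho g * (bracket x y : Mat n F) * rho g⁻¹ = (rho g * x * rho g⁻¹) * (rho g * y * rho g⁻¹)
    - koszul F i j • ((rho g * y * rho g⁻¹) * (rho g * x * rho g⁻¹))
  rw [bracket_coe hx hy, Ad_mul_coe, Ad_mul_coe]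
  simp [Matrix.mul_sub, Matrix.sub_mul]

variable (p : ℕ) [Fact p.Prime] [CharP F p]

theorem Ad_pMap (g : GL (Fin n) F) {x : pn n F} (hx : HasParity 0 x) :
    Ad g (pMap p x hx) = pMap p (Ad g x) (Ad_parity g hx) := by
  ext1
  change rho g * (x : Mat n F) ^ p * rho g⁻¹ = (rho g * (x : Mat n F) * rho g⁻¹) ^ p
  have key : ∀ k : ℕ, (rho g * (x : Mat n F) * rho g⁻¹) ^ k
      = rho g * (x : Mat n F) ^ k * rho g⁻¹ := by
    intro k
    induction k with
    | zero => simp [rho_mul_inv]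
    | succ k ih => rw [pow_succ, ih, Ad_mul_coe, pow_succ]
  exact (key p).symm

/-- The action of g on u(p(n)) by the algebra endomorphism that extends the adjoint action. -/
def actU (g : GL (Fin n) F) : U F p n →ₐ[F] U F p n :=
  RingQuot.liftAlgHom F ⟨TensorAlgebra.lift F (ιU F p n ∘ₗ Ad g), by
    intro a b h
    cases h with
    | bracket i j x y hx hy =>
      simp only [map_sub, map_mul, map_smul, TensorAlgebra.lift_ι_apply, LinearMap.comp_apply]
      rw [Ad_bracket g hx hy]
      exact ιU_bracket (Ad_parity g hx) (Ad_parity g hy)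
    | pPower x hx =>
      simp only [map_pow, TensorAlgebra.lift_ι_apply, LinearMap.comp_apply]
      rw [Ad_pMap p g hx]
      exact ιU_pPower (Ad_parity g hx)⟩

theorem actU_ιU (g : GL (Fin n) F) (x : pn n F) :
    actU p g (ιU F p n x) = ιU F p n (Ad g x) := by
  have h := RingQuot.liftAlgHom_mkAlgHom_apply F (s := URel F p n)
    (TensorAlgebra.lift F (ιU F p n ∘ₗ Ad g)) (by
      intro a b h
      cases h with
      | bracket i j x y hx hy =>
        simp only [map_sub, map_mul, map_smul, TensorAlgebra.lift_ι_apply, LinearMap.comp_apply]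
        rw [Ad_bracket g hx hy]
        exact ιU_bracket (Ad_parity g hx) (Ad_parity g hy)
      | pPower x hx =>
        simp only [map_pow, TensorAlgebra.lift_ι_apply, LinearMap.comp_apply]
        rw [Ad_pMap p g hx]
        exact ιU_pPower (Ad_parity g hx)) (TensorAlgebra.ι F x)
  rw [TensorAlgebra.lift_ι_apply] at h
  exact h

theorem actU_IRel (g : GL (Fin n) F) {a b : U F p n} (h : IRel F p n a b) :
    ((toUbar F p n).comp (actU p g)) a = ((toUbar F p n).comp (actU p g)) b := by
  cases h with
  | mk l hl hk =>
    have e : actU p g (l.map (ιU F p n)).prod = ((l.map (Ad g)).map (ιU F p n)).prod := by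
      rw [map_list_prod, List.map_map, List.map_map]
      congr 1
      exact List.map_congr_left fun x _ => actU_ιU p g x
    rw [map_zero, AlgHom.comp_apply, e]
    refine toUbar_prod _ ?_ (by simpa using hk)
    intro x hx
    obtain ⟨y, hy, rfl⟩ := List.mem_map.1 hx
    exact Ad_degOne g (hl y hy)

/-- The induced action of g on ū. -/
def act (g : GL (Fin n) F) : Ubar F p n →ₐ[F] Ubar F p n :=
  RingQuot.liftAlgHom F ⟨(toUbar F p n).comp (actU p g), fun _ _ h => actU_IRel p g h⟩

theorem act_ι (g : GL (Fin n) F) (x : pn n F) : act p g (ι F p n x) = ι F p n (Ad g x) := by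
  have h := RingQuot.liftAlgHom_mkAlgHom_apply F (s := IRel F p n)
    ((toUbar F p n).comp (actU p g)) (fun _ _ h => actU_IRel p g h) (ιU F p n x)
  rw [AlgHom.comp_apply, actU_ιU] at h
  exact h

variable (F n)

/-- The algebra 𝒵: even elements of ū that are fixed by GL(n) and (super)commute with the
elements of degree 1. The supercommutator with an even element is the ordinary one. -/
def centralZ : Set (Ubar F p n) :=
  {u | u ∈ evenUbar F p n ∧ (∀ g : GL (Fin n) F, act p g u = u) ∧
    ∀ x : pn n F, IsDegOne x → u * ι F p n x - ι F p n x * u = 0}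

/-- The invariants ūᵀ of the torus T of diagonal matrices in GL(n). -/
def torusInv : Submodule F (Ubar F p n) where
  carrier := {u | ∀ t : GL (Fin n) F, (t : Matrix (Fin n) (Fin n) F).IsDiag → act p t u = u}
  zero_mem' := by simp
  add_mem' := by
    intro a b ha hb t ht
    rw [map_add, ha t ht, hb t ht]
  smul_mem' := by
    intro r a ha t ht
    rw [map_smul, ha t ht]

/-- The left ideal ū𝔫⁺ generated by the positive root vectors of p(n). -/
def leftIdealPos : Ideal (Ubar F p n) :=
  Ideal.span {u | ∃ x : pn n F, (IsEvenPos x ∨ IsDegOne x) ∧ u = ι F p n x}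

/-- The space 𝔩 = ū𝔫⁺ ∩ ūᵀ, as a subspace of ūᵀ. -/
def lSub : Submodule F (torusInv F n p) :=
  ((leftIdealPos F n p).restrictScalars F).comap (torusInv F n p).subtype

end GroupAction

/-! ### The restricted enveloping algebra of the Cartan subalgebra, and the dot action -/

section Cartan

variable (F : Type*) [Field F] (p : ℕ) [Fact p.Prime] [CharP F p] (n : ℕ)

/-- The defining relations of u(𝔥). The maximal torus 𝔥 is described by coordinates in its basis
h₁, …, hₙ; it is abelian and its p-map is the coordinatewise p-th power. -/
inductive HRel : TensorAlgebra F (Fin n → F) → TensorAlgebra F (Fin n → F) → Prop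
  | comm (x y : Fin n → F) :
      HRel (TensorAlgebra.ι F x * TensorAlgebra.ι F y) (TensorAlgebra.ι F y * TensorAlgebra.ι F x)
  | pPower (x : Fin n → F) : HRel (TensorAlgebra.ι F x ^ p) (TensorAlgebra.ι F (x ^ p))

/-- The restricted enveloping algebra u(𝔥). -/
def Uh := RingQuot (HRel F p n)

instance : Ring (Uh F p n) := inferInstanceAs (Ring (RingQuot (HRel F p n)))
instance : Algebra F (Uh F p n) := inferInstanceAs (Algebra F (RingQuot (HRel F p n)))

/-- The canonical map from 𝔥 to u(𝔥). -/
def ιh : (Fin n → F) →ₗ[F] Uh F p n :=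
  (RingQuot.mkAlgHom F (HRel F p n)).toLinearMap ∘ₗ TensorAlgebra.ι F

variable {F n}

/-- The diagonal matrix diag(x, -x), that is, ∑ xᵢ hᵢ, as an element of p(n). -/
def cartanElt : (Fin n → F) →ₗ[F] pn n F where
  toFun x := ⟨fromBlocks (diagonal x) 0 0 (-(diagonal x)ᵀ),
    ⟨diagonal x, 0, 0, by simp, by simp, rfl⟩⟩
  map_add' x y := by
    ext1
    change fromBlocks (diagonal (x + y)) 0 0 (-(diagonal (x + y))ᵀ)
      = (fromBlocks (diagonal x) 0 0 (-(diagonal x)ᵀ) : Mat n F)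
        + fromBlocks (diagonal y) 0 0 (-(diagonal y)ᵀ)
    rw [fromBlocks_add, show diagonal (x + y) = diagonal x + diagonal y from (diagonal_add x y).symm, transpose_add, neg_add]
    simp only [add_zero]
  map_smul' r x := by
    ext1
    change fromBlocks (diagonal (r • x)) 0 0 (-(diagonal (r • x))ᵀ)
      = r • (fromBlocks (diagonal x) 0 0 (-(diagonal x)ᵀ) : Mat n F)
    rw [fromBlocks_smul, diagonal_smul, transpose_smul, smul_neg, smul_zero]

theorem cartanElt_parity (x : Fin n → F) : HasParity 0 (cartanElt x) := by
  simp [HasParity, cartanElt]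

theorem ιh_comm (x y : Fin n → F) : ιh F p n x * ιh F p n y = ιh F p n y * ιh F p n x := by
  have h := RingQuot.mkAlgHom_rel F (HRel.comm (p := p) x y)
  rw [map_mul, map_mul] at h
  exact h

theorem ιh_pPower (x : Fin n → F) : ιh F p n x ^ p = ιh F p n (x ^ p) := by
  have h := RingQuot.mkAlgHom_rel F (HRel.pPower (p := p) x)
  rw [map_pow] at h
  exact h

/-- The algebra homomorphism from u(𝔥) defined by a linear map on 𝔥 that respects the relations. -/
def liftUh {A : Type*} [Ring A] [Algebra F A] (f : (Fin n → F) →ₗ[F] A)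
    (hc : ∀ x y, f x * f y = f y * f x) (hp : ∀ x, f x ^ p = f (x ^ p)) : Uh F p n →ₐ[F] A :=
  RingQuot.liftAlgHom F ⟨TensorAlgebra.lift F f, by
    intro a b h
    cases h with
    | comm x y => simpa using hc x y
    | pPower x => simpa using hp x⟩

theorem liftUh_ιh {A : Type*} [Ring A] [Algebra F A] (f : (Fin n → F) →ₗ[F] A)
    (hc : ∀ x y, f x * f y = f y * f x) (hp : ∀ x, f x ^ p = f (x ^ p)) (x : Fin n → F) :
    liftUh p f hc hp (ιh F p n x) = f x := by
  have h := RingQuot.liftAlgHom_mkAlgHom_apply F (s := HRel F p n) (TensorAlgebra.lift F f) (by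
    intro a b h
    cases h with
    | comm x y => simpa using hc x y
    | pPower x => simpa using hp x) (TensorAlgebra.ι F x)
  rw [TensorAlgebra.lift_ι_apply] at h
  exact h

theorem uh_hom_ext {A : Type*} [Ring A] [Algebra F A] {f g : Uh F p n →ₐ[F] A}
    (h : ∀ x, f (ιh F p n x) = g (ιh F p n x)) : f = g := by
  refine RingQuot.ringQuot_ext' F f g ?_
  refine TensorAlgebra.hom_ext (LinearMap.ext fun x => ?_)
  exact h x

theorem ι_cartan_comm (x y : Fin n → F) :
    ι F p n (cartanElt x) * ι F p n (cartanElt y)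
      = ι F p n (cartanElt y) * ι F p n (cartanElt x) := by
  have h := ιU_bracket (p := p) (cartanElt_parity x) (cartanElt_parity y)
  have hb : bracket (cartanElt x) (cartanElt y) = 0 := by
    ext1
    rw [bracket_coe (cartanElt_parity x) (cartanElt_parity y)]
    change (fromBlocks (diagonal x) 0 0 (-(diagonal x)ᵀ) : Mat n F)
        * fromBlocks (diagonal y) 0 0 (-(diagonal y)ᵀ)
        - koszul F 0 0 • (fromBlocks (diagonal y) 0 0 (-(diagonal y)ᵀ)
          * fromBlocks (diagonal x) 0 0 (-(diagonal x)ᵀ)) = 0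
    simp only [koszul, zero_ne_one, and_self, if_false, one_smul, fromBlocks_multiply,
      Matrix.mul_zero, Matrix.zero_mul, add_zero, zero_add, diagonal_transpose,
      neg_mul_neg, diagonal_mul_diagonal, mul_comm, sub_self]
  rw [hb, map_zero] at h
  have h' := congrArg (toUbar F p n) h
  simp only [koszul, zero_ne_one, and_self, if_false, one_smul, map_sub, map_mul, map_zero] at h'
  exact sub_eq_zero.1 h'

theorem ι_cartan_pow (x : Fin n → F) :
    ι F p n (cartanElt x) ^ p = ι F p n (cartanElt (x ^ p)) := by
  have h := ιU_pPower (p := p) (cartanElt_parity x)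
  have hb : pMap p (cartanElt x) (cartanElt_parity x) = cartanElt (x ^ p) := by
    ext1
    change (fromBlocks (diagonal x) 0 0 (-(diagonal x)ᵀ) : Mat n F) ^ p
      = fromBlocks (diagonal (x ^ p)) 0 0 (-(diagonal (x ^ p))ᵀ)
    have h1 : ((-1 : F)) ^ p = -1 := neg_one_pow_char F p
    have h2 : (-(diagonal x)ᵀ) = (-1 : F) • diagonal x := by simp
    rw [fromBlocks_diag_pow, h2, smul_pow, h1, diagonal_pow]
    simp
  rw [hb] at h
  have h' := congrArg (toUbar F p n) h
  rw [map_pow] at h'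
  exact h'

variable (F n)

/-- The canonical map from u(𝔥) to ū. -/
def cartanMap : Uh F p n →ₐ[F] Ubar F p n :=
  liftUh p (ι F p n ∘ₗ cartanElt) (ι_cartan_comm p) (ι_cartan_pow p)

theorem cartanMap_mem (f : Uh F p n) : cartanMap F p n f ∈ torusInv F n p := by
  intro t ht
  suffices h : (act p t).comp (cartanMap F p n) = cartanMap F p n from DFunLike.congr_fun h f
  refine uh_hom_ext p fun x => ?_
  rw [AlgHom.comp_apply, cartanMap, liftUh_ιh, LinearMap.comp_apply, act_ι]
  congr 1
  ext1
  rw [Ad_blocks]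
  have hd : t.1 = diagonal (diag t.1) := ht.diagonal_diag.symm
  have hcm : t.1 * diagonal x = diagonal x * t.1 := by
    rw [hd]; simp [mul_comm]
  have e1 : t.1 * diagonal x * (t⁻¹).1 = diagonal x := by
    rw [hcm, Matrix.mul_assoc, ← Units.val_mul]; simp
  have e2 : (t⁻¹).1ᵀ * diagonal x * t.1ᵀ = diagonal x := by
    have h3 : t.1 * (diagonal x * (t⁻¹).1) = diagonal x := by
      rw [← Matrix.mul_assoc, e1]
    have h4 := congrArg transpose h3
    simp only [transpose_mul, diagonal_transpose] at h4
    exact h4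
  simp only [cartanElt, LinearMap.coe_mk, AddHom.coe_mk, toBlocks_fromBlocks₁₁,
    toBlocks_fromBlocks₁₂, toBlocks_fromBlocks₂₁, toBlocks_fromBlocks₂₂, e1, diagonal_transpose,
    Matrix.mul_neg, Matrix.neg_mul, e2, Matrix.mul_zero, Matrix.zero_mul]

/-- The property that pins down the Harish-Chandra homomorphism ūᵀ → u(𝔥): it is the projection of
ūᵀ onto its subspace u(𝔥) with kernel 𝔩. -/
def IsHarishChandra (h : torusInv F n p →ₗ[F] Uh F p n) : Prop :=
  (∀ f : Uh F p n, h ⟨cartanMap F p n f, cartanMap_mem F p n f⟩ = f) ∧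
    LinearMap.ker h = lSub F n p

variable {F n}

/-- A weight ρ with ρ(hᵢ - hᵢ₊₁) = 1 for all i, in coordinates with respect to ε₁, …, εₙ. -/
def rhoWeight (i : Fin n) : F := -((i : ℕ) : F)

/-- The dot action w · μ = w(μ + ρ) - ρ on 𝔥* of the Weyl group, which is the symmetric group
acting by w εᵢ = ε_{w(i)}. -/
def dotWeight (w : Equiv.Perm (Fin n)) (μ : Fin n → F) : Fin n → F :=
  fun i => (μ (w⁻¹ i) + rhoWeight (w⁻¹ i)) - rhoWeight i

/-- The dot action on an element x of 𝔥, viewed as a function on 𝔥*: the polynomial function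
w · x of degree at most one equals w(x) + x(w⁻¹ · 0). -/
def dotGen (w : Equiv.Perm (Fin n)) : (Fin n → F) →ₗ[F] Uh F p n where
  toFun x := ιh F p n (fun i => x (w⁻¹ i))
    + algebraMap F (Uh F p n) (∑ i, x i * dotWeight w⁻¹ 0 i)
  map_add' x y := by
    have : (fun i => (x + y) (w⁻¹ i)) = (fun i => x (w⁻¹ i)) + fun i => y (w⁻¹ i) := rfl
    rw [this, map_add]
    simp only [Pi.add_apply, add_mul, Finset.sum_add_distrib, map_add]
    abel
  map_smul' r x := by
    have : (fun i => (r • x) (w⁻¹ i)) = r • fun i => x (w⁻¹ i) := rfl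
    rw [this, map_smul]
    simp only [Pi.smul_apply, smul_eq_mul, mul_assoc, ← Finset.mul_sum, map_mul, mul_add,
      RingHom.id_apply, Algebra.smul_def]

/-- The function on 𝔥* given by `dotGen w x` is μ ↦ x(w⁻¹ · μ). -/
theorem dotGen_eval (w : Equiv.Perm (Fin n)) (x μ : Fin n → F) :
    ∑ i, x (w⁻¹ i) * μ i + ∑ i, x i * dotWeight w⁻¹ 0 i = ∑ i, x i * dotWeight w⁻¹ μ i := by
  rw [← Equiv.sum_comp w fun i => x (w⁻¹ i) * μ i, ← Finset.sum_add_distrib]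
  refine Finset.sum_congr rfl fun i _ => ?_
  simp [dotWeight]
  ring

theorem dotGen_comm (w : Equiv.Perm (Fin n)) (x y : Fin n → F) :
    dotGen p w x * dotGen p w y = dotGen p w y * dotGen p w x := by
  simp only [dotGen, LinearMap.coe_mk, AddHom.coe_mk]
  exact ((Commute.add_right (ιh_comm p _ _) (Algebra.commutes _ _).symm).add_left
    (Algebra.commutes _ _))

theorem dotGen_pow (w : Equiv.Perm (Fin n)) (x : Fin n → F) :
    dotGen p w x ^ p = dotGen p w (x ^ p) := by
  simp only [dotGen, LinearMap.coe_mk, AddHom.coe_mk]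
  obtain ⟨r, hr⟩ := (show Commute (ιh F p n fun i => x (w⁻¹ i))
      (algebraMap F (Uh F p n) (∑ i, x i * dotWeight w⁻¹ 0 i)) from
    (Algebra.commutes _ _).symm).exists_add_pow_prime_eq (Fact.out : p.Prime)
  have h0 : ((p : ℕ) : Uh F p n) = 0 := by
    rw [← map_natCast (algebraMap F (Uh F p n)), CharP.cast_eq_zero, map_zero]
  have hn : ∀ m : ℕ, ((m : F)) ^ p = m := fun m => by
    rw [← frobenius_def, map_natCast]
  have hd : ∀ i, dotWeight w⁻¹ (0 : Fin n → F) i ^ p = dotWeight w⁻¹ 0 i := by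
    intro i
    have : dotWeight w⁻¹ (0 : Fin n → F) i
        = ((i : ℕ) : F) - (((w⁻¹)⁻¹ i : Fin n) : ℕ) := by
      simp [dotWeight, rhoWeight]; ring
    rw [this, sub_pow_char, hn, hn]
  rw [hr, h0, zero_mul, zero_mul, zero_mul, add_zero, ιh_pPower, ← map_pow, sum_pow_char]
  simp only [mul_pow, hd]
  rfl

/-- The dot action of the Weyl group on u(𝔥), by algebra endomorphisms. -/
def dotAct (w : Equiv.Perm (Fin n)) : Uh F p n →ₐ[F] Uh F p n :=
  liftUh p (dotGen p w) (dotGen_comm p w) (dotGen_pow p w)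

variable (F n)

/-- The invariants of the dot action in u(𝔥). -/
def dotInv : Set (Uh F p n) := {f | ∀ w : Equiv.Perm (Fin n), dotAct p w f = f}

end Cartan

end Periplectic

end

/-! In a ū-module, a vector `v` of weight `λ` killed by 𝔫⁺ is an eigenvector of every torus
invariant `z`, with eigenvalue `h(z)(λ)`, because `z` agrees with `h(z)` modulo ū𝔫⁺. As u(𝔥) is
the algebra of functions on the weights with coordinates in the prime field, everything reduces to
producing such singular vectors for each of these weights.

They exist: divided powers inside tensor powers of the natural module realise all these weights,
and in the submodule generated by the 𝔤₁-invariants products of more than `d = dim 𝔤₋₁` elements of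
𝔤₁ act by zero, so that ū acts there. Hence u(𝔥) meets ū𝔫⁺ trivially. Together with ū𝔫⁺ it
spans the torus invariants, since a suitable one-parameter torus has positive degree on all negative
root vectors. This gives `h` and its uniqueness.

For a simple root `εᵢ - εⱼ` with negative root vector `f`, take `0 ≤ k < p` with
`k ≡ λᵢ - λⱼ + 1` modulo `p`. By the 𝔰𝔩₂ relations `f ^ k v` is singular of weight `s · λ`, and the
divided power modules can be chosen so that it does not vanish. A `GL n`-invariant `z` commutes with
`f`, as one sees by differentiating along transvections, and so `h(z)` takes equal values at `λ` and
`s · λ`.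
-/

noncomputable section

namespace Periplectic

section Generators

variable {F : Type*} [Field F] {p : ℕ} {n : ℕ}

theorem adjoin_range_eq_top_of_surjective {V A : Type*} [AddCommGroup V] [Module F V] [Ring A]
    [Algebra F A] {π : TensorAlgebra F V →ₐ[F] A} (hπ : Function.Surjective π) :
    Algebra.adjoin F (Set.range fun v => π (TensorAlgebra.ι F v)) = ⊤ := by
  rw [Set.range_comp' π, ← AlgHom.map_adjoin, TensorAlgebra.adjoin_range_ι, Algebra.map_top]
  exact (AlgHom.range_eq_top π).2 hπ

theorem adjoin_range_ιh : Algebra.adjoin F (Set.range (ιh F p n)) = ⊤ :=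
  adjoin_range_eq_top_of_surjective (RingQuot.mkAlgHom_surjective F (HRel F p n))

variable [Fact p.Prime] [CharP F p]

theorem adjoin_range_ι : Algebra.adjoin F (Set.range (ι F p n)) = ⊤ :=
  adjoin_range_eq_top_of_surjective
    (π := (toUbar F p n).comp (RingQuot.mkAlgHom F (URel F p n)))
    ((RingQuot.mkAlgHom_surjective F (IRel F p n)).comp
      (RingQuot.mkAlgHom_surjective F (URel F p n)))

theorem ι_bracket {i j : ZMod 2} {x y : pn n F} (hx : HasParity i x) (hy : HasParity j y) :
    ι F p n x * ι F p n y - koszul F i j • (ι F p n y * ι F p n x) = ι F p n (bracket x y) := by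
  have h := congrArg (toUbar F p n) (ιU_bracket (p := p) hx hy)
  rwa [map_sub, map_smul, map_mul, map_mul] at h

end Generators

section CartanCharacters

variable {F : Type*} [Field F] {p : ℕ} [Fact p.Prime] [CharP F p] {n : ℕ}

variable (F) in
/-- The weight of 𝔥 over F defined by a weight with values in the prime field. These are the
weights of the restricted representations of 𝔥. -/
def weightCast (lam : Fin n → ZMod p) : Fin n → F := fun i => ZMod.castHom (dvd_refl p) F (lam i)

theorem weightCast_pow (lam : Fin n → ZMod p) (i : Fin n) :
    weightCast F lam i ^ p = weightCast F lam i := by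
  rw [weightCast, ← map_pow, ZMod.pow_card]

theorem weightCast_dotWeight (w : Equiv.Perm (Fin n)) (lam : Fin n → ZMod p) :
    weightCast F (dotWeight w lam) = dotWeight w (weightCast F lam) := by
  ext i
  simp only [weightCast, dotWeight, rhoWeight, map_sub, map_add, map_neg, map_natCast]

variable (F) in
/-- The character of u(𝔥) at a weight with values in the prime field. -/
def ev (lam : Fin n → ZMod p) : Uh F p n →ₐ[F] F :=
  liftUh p (Fintype.linearCombination F (weightCast F lam)) (fun _ _ => mul_comm _ _) fun x => by
    simp only [Fintype.linearCombination_apply, smul_eq_mul, sum_pow_char, mul_pow, Pi.pow_apply,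
      weightCast_pow]

theorem ev_ιh (lam : Fin n → ZMod p) (x : Fin n → F) :
    ev F lam (ιh F p n x) = ∑ i, x i * weightCast F lam i := by
  rw [ev, liftUh_ιh, Fintype.linearCombination_apply]
  rfl

theorem uh_mul_comm (a b : Uh F p n) : a * b = b * a := by
  have hmem (c : Uh F p n) : c ∈ Algebra.adjoin F (Set.range (ιh F p n)) :=
    adjoin_range_ιh (F := F) ▸ Algebra.mem_top
  refine Algebra.commute_of_mem_adjoin_of_forall_mem_commute (hmem b) ?_
  rintro _ ⟨y, rfl⟩
  refine (Algebra.commute_of_mem_adjoin_of_forall_mem_commute (hmem a) ?_).symm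
  rintro _ ⟨x, rfl⟩
  exact ιh_comm p y x

-- Local, as it opens a second instance path to the ring structure of `Uh`.
local instance : CommRing (Uh F p n) where
  mul_comm := uh_mul_comm

/-- The algebra u(𝔥) as a quotient of the algebra of polynomial functions on 𝔥*: the variable of
index i goes to hᵢ. -/
def ofPoly : MvPolynomial (Fin n) F →ₐ[F] Uh F p n :=
  MvPolynomial.aeval fun i => ιh F p n (Pi.single i 1)

theorem sum_smul_ιh_single (x : Fin n → F) : ∑ i, x i • ιh F p n (Pi.single i 1) = ιh F p n x := by
  simp only [← map_smul, ← map_sum, ← pi_eq_sum_univ' x]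

theorem ofPoly_surjective :
    Function.Surjective (ofPoly : MvPolynomial (Fin n) F →ₐ[F] Uh F p n) := by
  rw [← AlgHom.range_eq_top, eq_top_iff, ← adjoin_range_ιh, Algebra.adjoin_le_iff]
  rintro _ ⟨x, rfl⟩
  refine ⟨∑ i, x i • MvPolynomial.X i, show ofPoly _ = _ from ?_⟩
  simp only [ofPoly, map_sum, map_smul, MvPolynomial.aeval_X, sum_smul_ιh_single]

theorem ev_ofPoly (lam : Fin n → ZMod p) (P : MvPolynomial (Fin n) F) :
    ev F lam (ofPoly P) = MvPolynomial.eval (weightCast F lam) P := by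
  suffices h : (ev F lam).comp ofPoly = MvPolynomial.aeval (weightCast F lam) from
    DFunLike.congr_fun h P
  ext i
  simp [ofPoly, ev_ιh, Pi.single_apply]

theorem prod_X_sub_C_castHom : ∏ c : ZMod p,
    (Polynomial.X - Polynomial.C (ZMod.castHom (dvd_refl p) F c)) =
      Polynomial.X ^ p - Polynomial.X := by
  have hp := (Fact.out : p.Prime).one_lt
  have hr : (Polynomial.X ^ p - Polynomial.X : Polynomial (ZMod p)).roots = Finset.univ.val := by
    simpa using FiniteField.roots_X_pow_card_sub_X (ZMod p)
  have h := Polynomial.prod_multiset_X_sub_C_of_monic_of_roots_card_eq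
    (p := (Polynomial.X ^ p - Polynomial.X : Polynomial (ZMod p)))
    (Polynomial.monic_X_pow_sub (by simpa using hp))
    (by rw [hr, FiniteField.X_pow_card_sub_X_natDegree_eq _ hp]; simp)
  rw [hr] at h
  have h' := congrArg (Polynomial.map (ZMod.castHom (dvd_refl p) F)) h
  rw [← Finset.prod_eq_multiset_prod, Polynomial.map_prod] at h'
  simpa using h'

theorem ofPoly_prod_X_sub_C (i : Fin n) :
    ofPoly (∏ c : ZMod p,
      (MvPolynomial.X i - MvPolynomial.C (ZMod.castHom (dvd_refl p) F c))) = (0 : Uh F p n) := by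
  have h := congrArg (Polynomial.aeval (ιh F p n (Pi.single i 1)))
    (prod_X_sub_C_castHom (F := F) (p := p))
  have hsingle : (Pi.single i 1 : Fin n → F) ^ p = Pi.single i 1 := by
    ext j
    rcases eq_or_ne j i with rfl | hj
    · simp
    · simp [hj, (Fact.out : p.Prime).ne_zero]
  simpa [ofPoly, ιh_pPower, hsingle] using h

theorem eq_zero_of_ev_eq_zero {f : Uh F p n} (hf : ∀ lam : Fin n → ZMod p, ev F lam f = 0) :
    f = 0 := by
  obtain ⟨P, rfl⟩ := ofPoly_surjective f
  let S : Finset F := Finset.univ.map ⟨_, ZMod.castHom_injective F⟩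
  have hP (x : Fin n → F) (hx : ∀ i, x i ∈ S) : MvPolynomial.eval x P = 0 := by
    choose lam _ hlam using fun i => Finset.mem_map.1 (hx i)
    rw [← funext hlam, ← hf lam, ev_ofPoly]
    rfl
  obtain ⟨Q, -, hQ⟩ := MvPolynomial.combinatorial_nullstellensatz_exists_linearCombination
    (fun _ => S) (fun _ => Finset.univ_nonempty.map) P hP
  rw [hQ, Finsupp.linearCombination_apply, Finsupp.sum, map_sum]
  refine Finset.sum_eq_zero fun i _ => ?_
  rw [smul_eq_mul, map_mul, Finset.prod_map]
  exact mul_eq_zero_of_right _ (ofPoly_prod_X_sub_C i)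

theorem eq_of_ev_eq {f g : Uh F p n} (h : ∀ lam : Fin n → ZMod p, ev F lam f = ev F lam g) :
    f = g :=
  sub_eq_zero.1 <| eq_zero_of_ev_eq_zero fun lam => by rw [map_sub, h, sub_self]

theorem ev_dotAct (w : Equiv.Perm (Fin n)) (lam : Fin n → ZMod p) (f : Uh F p n) :
    ev F lam (dotAct p w f) = ev F (dotWeight w⁻¹ lam) f := by
  suffices h : (ev F lam).comp (dotAct p w) = ev F (dotWeight w⁻¹ lam) from DFunLike.congr_fun h f
  refine uh_hom_ext p fun x => ?_
  rw [AlgHom.comp_apply, dotAct, liftUh_ιh, ev_ιh, weightCast_dotWeight, ← dotGen_eval]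
  simp only [dotGen, LinearMap.coe_mk, AddHom.coe_mk, map_add, ev_ιh, AlgHom.commutes]
  rfl

theorem dotWeight_one (lam : Fin n → F) : dotWeight 1 lam = lam := by
  ext i
  simp [dotWeight]

theorem dotWeight_mul (w w' : Equiv.Perm (Fin n)) (lam : Fin n → F) :
    dotWeight (w * w') lam = dotWeight w (dotWeight w' lam) := by
  ext i
  simp [dotWeight]

theorem closure_swap_covBy :
    Submonoid.closure {w : Equiv.Perm (Fin n) | ∃ i j, i ⋖ j ∧ w = Equiv.swap i j} = ⊤ := by
  obtain _ | n := n
  · exact Subsingleton.elim _ _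
  · rw [eq_top_iff, ← Equiv.Perm.mclosure_swap_castSucc_succ]
    refine Submonoid.closure_mono ?_
    rintro _ ⟨i, rfl⟩
    exact ⟨_, _, Fin.covBy_iff.2 (Order.covBy_add_one (i : ℕ)), rfl⟩

theorem mem_dotInv_of_simple {f : Uh F p n}
    (hf : ∀ i j : Fin n, i ⋖ j → ∀ lam : Fin n → ZMod p,
      ev F (dotWeight (Equiv.swap i j) lam) f = ev F lam f) : f ∈ dotInv F p n := by
  have key (w : Equiv.Perm (Fin n)) : ∀ lam : Fin n → ZMod p,
      ev F (dotWeight w lam) f = ev F lam f := by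
    induction show w ∈ Submonoid.closure _ from closure_swap_covBy ▸ Submonoid.mem_top w
      using Submonoid.closure_induction with
    | mem w hw =>
      obtain ⟨i, j, hij, rfl⟩ := hw
      exact hf i j hij
    | one => exact fun lam => by rw [dotWeight_one]
    | mul w w' _ _ h h' => exact fun lam => by rw [dotWeight_mul, h, h']
  exact fun w => eq_of_ev_eq fun lam => by rw [ev_dotAct, key]

end CartanCharacters

section Parity

variable {F : Type*} [Field F] {n : ℕ}

theorem zmod_two_cases (i : ZMod 2) : i = 0 ∨ i = 1 := by
  revert i; decide

theorem koszul_comm (i j : ZMod 2) : koszul F i j = koszul F j i := by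
  simp only [koszul, and_comm]

theorem koszul_mul_self (i j : ZMod 2) : koszul F i j * koszul F i j = 1 := by
  unfold koszul; split_ifs <;> simp

theorem koszul_zero_left (j : ZMod 2) : koszul F 0 j = 1 := by
  simp [koszul]

theorem koszul_zero_right (i : ZMod 2) : koszul F i 0 = 1 := by
  simp [koszul]

theorem HasParity.bracket {i j : ZMod 2} {x y : pn n F} (hx : HasParity i x)
    (hy : HasParity j y) : HasParity (i + j) (bracket x y) := by
  unfold HasParity
  rw [bracket_coe hx hy]
  obtain ⟨x, a, b, c, hb, hc, rfl⟩ := x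
  obtain ⟨y, a', b', c', hb', hc', rfl⟩ := y
  rcases zmod_two_cases i with rfl | rfl <;> rcases zmod_two_cases j with rfl | rfl <;>
    simp_all [HasParity, fromBlocks_multiply, sub_eq_add_neg, fromBlocks_neg, fromBlocks_add,
      fromBlocks_smul, show (1 + 1 : ZMod 2) = 0 from rfl]

theorem pMap_parity {p : ℕ} [Fact p.Prime] [CharP F p] {x : pn n F} (hx : HasParity 0 x) :
    HasParity 0 (pMap p x hx) := by
  obtain ⟨a, ha⟩ := even_eq hx
  simp [HasParity, pMap, ha, fromBlocks_diag_pow]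

theorem IsDegOne.hasParity {x : pn n F} (hx : IsDegOne x) : HasParity 1 x := hx.1

/-- The element of the even part of p(n) defined by a square matrix. -/
def evenElt : Matrix (Fin n) (Fin n) F →ₗ[F] pn n F where
  toFun a := ⟨fromBlocks a 0 0 (-aᵀ), ⟨a, 0, 0, by simp, by simp, rfl⟩⟩
  map_add' a b := by
    ext1
    simp only [Submodule.coe_add, fromBlocks_add, transpose_add, neg_add, add_zero]
  map_smul' r a := by
    ext1
    simp only [Submodule.coe_smul, fromBlocks_smul, transpose_smul, smul_neg, smul_zero,
      RingHom.id_apply]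

theorem evenElt_coe (a : Matrix (Fin n) (Fin n) F) :
    (evenElt a : Mat n F) = fromBlocks a 0 0 (-aᵀ) := rfl

theorem evenElt_parity (a : Matrix (Fin n) (Fin n) F) : HasParity 0 (evenElt a) := by
  simp [HasParity, evenElt_coe]

theorem eq_evenElt {x : pn n F} (hx : HasParity 0 x) :
    x = evenElt (x : Mat n F).toBlocks₁₁ := by
  obtain ⟨a, ha⟩ := even_eq hx
  ext1
  rw [evenElt_coe, ha, toBlocks_fromBlocks₁₁]

theorem cartanElt_eq (x : Fin n → F) : cartanElt x = evenElt (diagonal x) := rfl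

theorem bracket_evenElt (a b : Matrix (Fin n) (Fin n) F) :
    bracket (evenElt a) (evenElt b) = evenElt (a * b - b * a) := by
  ext1
  rw [bracket_coe (evenElt_parity a) (evenElt_parity b)]
  simp only [koszul_zero_left, evenElt_coe, fromBlocks_multiply, one_smul, sub_eq_add_neg,
    fromBlocks_neg, fromBlocks_add]
  congr 1 <;> simp

variable (F) in
/-- The root vector of the root εᵢ - εⱼ of the even part. -/
def rootElt (i j : Fin n) : pn n F := evenElt (Matrix.single i j 1)

theorem rootElt_parity (i j : Fin n) : HasParity 0 (rootElt F i j) := evenElt_parity _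

variable (F n) in
/-- The projection of p(n) onto its odd part. -/
def oddProj : pn n F →ₗ[F] pn n F where
  toFun x := ⟨oddPart x, by
    obtain ⟨x, a, b, c, hb, hc, rfl⟩ := x
    exact ⟨0, b, c, hb, hc, by simp [oddPart]⟩⟩
  map_add' x y := by
    ext1
    simp only [Submodule.coe_add, oddPart, fromBlocks_add, add_zero]
    rfl
  map_smul' r x := by
    ext1
    simp only [Submodule.coe_smul, oddPart, fromBlocks_smul, smul_zero, RingHom.id_apply]
    rfl

theorem oddProj_of_even {x : pn n F} (hx : HasParity 0 x) : oddProj F n x = 0 := by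
  rw [eq_evenElt hx]
  ext1
  simp [oddProj, oddPart, evenElt_coe]

theorem oddProj_of_odd {x : pn n F} (hx : HasParity 1 x) : oddProj F n x = x := by
  obtain ⟨x, a, b, c, hb, hc, rfl⟩ := x
  simp_all [HasParity, oddProj, oddPart]

variable (F n) in
/-- The operator (-1)^(i|·|) on the natural module, as a matrix. -/
def signMat (i : ZMod 2) : Mat n F := fromBlocks 1 0 0 (koszul F i 1 • 1)

theorem signMat_zero : signMat F n 0 = 1 := by
  rw [signMat, koszul_zero_left, one_smul, fromBlocks_one]

theorem signMat_mul (i j : ZMod 2) : signMat F n i * signMat F n j = signMat F n (i + j) := by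
  rcases zmod_two_cases i with rfl | rfl <;> rcases zmod_two_cases j with rfl | rfl <;>
    simp [signMat, koszul, fromBlocks_multiply, show (1 + 1 : ZMod 2) = 0 from rfl]

theorem mul_signMat {i : ZMod 2} (j : ZMod 2) {x : pn n F} (hx : HasParity i x) :
    (x : Mat n F) * signMat F n j = koszul F i j • (signMat F n j * (x : Mat n F)) := by
  obtain ⟨x, a, b, c, hb, hc, rfl⟩ := x
  rcases zmod_two_cases i with rfl | rfl <;> rcases zmod_two_cases j with rfl | rfl <;>
    simp_all [HasParity, koszul, signMat, fromBlocks_multiply, fromBlocks_neg]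

end Parity

section NaturalTensor

variable {F : Type*} [Field F] {n : ℕ}

/-- The linear maps from p(n) to an algebra that satisfy the relations of u(p(n)). -/
structure IsRep (p : ℕ) [Fact p.Prime] [CharP F p] {A : Type*} [Ring A] [Algebra F A]
    (φ : pn n F →ₗ[F] A) : Prop where
  bracket : ∀ (i j : ZMod 2) (x y : pn n F), HasParity i x → HasParity j y →
    φ x * φ y - koszul F i j • (φ y * φ x) = φ (bracket x y)
  pPower : ∀ (x : pn n F) (hx : HasParity 0 x), φ x ^ p = φ (pMap p x hx)

variable {R : Type*} [AddCommGroup R] [Module F R]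

open scoped Matrix.Module in
variable (n R) in
/-- The action of matrices on the tensor product of the natural module with R, whose elements are
written as families of elements of R indexed by the basis of the natural module. -/
def matAct : Mat n F →ₐ[F] Module.End F (Fin n ⊕ Fin n → R) := Algebra.lsmul F F _

theorem matAct_apply (X : Mat n F) (G : Fin n ⊕ Fin n → R) (b : Fin n ⊕ Fin n) :
    matAct n R X G b = ∑ c, X b c • G c := rfl

variable (F n R) in
/-- The action of End(R) on the second factor of the tensor product of the natural module
with R, without signs. -/
def endAct : Module.End F R →ₐ[F] Module.End F (Fin n ⊕ Fin n → R) where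
  toFun T := T.compLeft _
  map_one' := rfl
  map_mul' _ _ := rfl
  map_zero' := rfl
  map_add' _ _ := rfl
  commutes' _ := rfl

theorem endAct_apply (T : Module.End F R) (G : Fin n ⊕ Fin n → R) (b : Fin n ⊕ Fin n) :
    endAct F n R T G b = T (G b) := rfl

theorem commute_matAct_endAct (X : Mat n F) (T : Module.End F R) :
    Commute (matAct n R X) (endAct F n R T) := by
  refine LinearMap.ext fun G => funext fun b => ?_
  simp [matAct_apply, endAct_apply]

theorem matAct_mul_sign_mul_endAct {i : ZMod 2} (j : ZMod 2) {x : pn n F} (hx : HasParity i x)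
    (T : Module.End F R) :
    matAct n R x * (matAct n R (signMat F n j) * endAct F n R T) =
      koszul F i j • (matAct n R (signMat F n j) * endAct F n R T * matAct n R x) := by
  rw [← mul_assoc, ← map_mul, mul_signMat j hx, map_smul, map_mul, smul_mul_assoc, mul_assoc,
    mul_assoc, (commute_matAct_endAct (x : Mat n F) T).eq]

theorem sign_mul_endAct_mul (i j : ZMod 2) (S T : Module.End F R) :
    matAct n R (signMat F n i) * endAct F n R S * (matAct n R (signMat F n j) * endAct F n R T) =
      matAct n R (signMat F n (i + j)) * endAct F n R (S * T) := by
  rw [← signMat_mul, map_mul, map_mul, mul_assoc, ← mul_assoc (endAct F n R S),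
    ← (commute_matAct_endAct (signMat F n j) S).eq]
  simp only [mul_assoc]

/-- The representation on the tensor product of the natural module with a representation on R. An
odd element acts on R with the sign by which it is moved past the natural module. -/
def natTensor (φ : pn n F →ₗ[F] Module.End F R) :
    pn n F →ₗ[F] Module.End F (Fin n ⊕ Fin n → R) :=
  (matAct n R).toLinearMap ∘ₗ (pn n F).subtype
    + (endAct F n R).toLinearMap ∘ₗ φ ∘ₗ (LinearMap.id - oddProj F n)
    + LinearMap.mulLeft F (matAct n R (signMat F n 1)) ∘ₗ (endAct F n R).toLinearMap ∘ₗ φ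
      ∘ₗ oddProj F n

theorem natTensor_of_parity (φ : pn n F →ₗ[F] Module.End F R) {i : ZMod 2} {x : pn n F}
    (hx : HasParity i x) :
    natTensor φ x = matAct n R x + matAct n R (signMat F n i) * endAct F n R (φ x) := by
  rcases zmod_two_cases i with rfl | rfl
  · simp [natTensor, oddProj_of_even hx, signMat_zero]
  · simp [natTensor, oddProj_of_odd hx]

theorem natTensor_apply_inl (φ : pn n F →ₗ[F] Module.End F R) {i : ZMod 2} {x : pn n F}
    (hx : HasParity i x) (G : Fin n ⊕ Fin n → R) (k : Fin n) :
    natTensor φ x G (.inl k) = ∑ c, (x : Mat n F) (.inl k) c • G c + φ x (G (.inl k)) := by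
  rw [natTensor_of_parity φ hx]
  simp [matAct_apply, endAct_apply, signMat, Matrix.one_apply]

theorem natTensor_apply_inr (φ : pn n F →ₗ[F] Module.End F R) {i : ZMod 2} {x : pn n F}
    (hx : HasParity i x) (G : Fin n ⊕ Fin n → R) (k : Fin n) :
    natTensor φ x G (.inr k) =
      ∑ c, (x : Mat n F) (.inr k) c • G c + koszul F i 1 • φ x (G (.inr k)) := by
  rw [natTensor_of_parity φ hx]
  simp [matAct_apply, endAct_apply, signMat, Matrix.one_apply]

theorem IsRep.natTensor {p : ℕ} [Fact p.Prime] [CharP F p] {φ : pn n F →ₗ[F] Module.End F R}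
    (h : IsRep p φ) : IsRep p (natTensor φ) where
  bracket i j x y hx hy := by
    rw [natTensor_of_parity φ hx, natTensor_of_parity φ hy,
      natTensor_of_parity φ (hx.bracket hy), ← h.bracket i j x y hx hy]
    simp only [add_mul, mul_add, smul_add, map_sub, map_smul, map_mul, bracket_coe hx hy,
      matAct_mul_sign_mul_endAct j hx, matAct_mul_sign_mul_endAct i hy, sign_mul_endAct_mul,
      koszul_comm j i, add_comm j i, smul_smul, koszul_mul_self, one_smul, mul_sub, mul_smul_comm]
    abel
  pPower x hx := by
    cases subsingleton_or_nontrivial (Module.End F (Fin n ⊕ Fin n → R))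
    · exact Subsingleton.elim _ _
    have := charP_of_injective_algebraMap' F (A := Module.End F (Fin n ⊕ Fin n → R)) p
    rw [natTensor_of_parity φ hx, natTensor_of_parity φ (pMap_parity hx), signMat_zero, map_one,
      one_mul, one_mul, add_pow_char_of_commute _ (commute_matAct_endAct (x : Mat n F) (φ x)),
      ← map_pow, ← map_pow, h.pPower x hx]
    rfl

end NaturalTensor

section DividedPowers

variable {F : Type*} [Field F] {p : ℕ} [Fact p.Prime] [CharP F p] {n : ℕ}

/-- The shift of exponents of divided power monomials by the root εᵢ - εⱼ. -/
def shift (i j : Fin n) (μ : Fin n → ℤ) : Fin n → ℤ := μ + Pi.single i 1 - Pi.single j 1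

variable {R R' : Type*} [AddCommGroup R] [Module F R] [AddCommGroup R'] [Module F R']

variable (p) in
/-- A representation on R' with maps Ψ μ from R to R' that behave like the maps w ↦ x^(μ) ⊗ w to the
tensor product of the N-th divided power of the natural module with R, where x^(μ) is a divided
power monomial in the even basis vectors. Instead of constructing divided powers, one obtains R'
inside the N-fold tensor product with the natural module. -/
structure IsDividedPower (φ : pn n F →ₗ[F] Module.End F R) (φ' : pn n F →ₗ[F] Module.End F R')
    (N : ℕ) (Ψ : (Fin n → ℤ) → R →ₗ[F] R') : Prop where
  isRep : IsRep p φ'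
  degOne : ∀ b, IsDegOne b → ∀ μ w, φ' b (Ψ μ w) = Ψ μ (φ b w)
  even : ∀ (a : Matrix (Fin n) (Fin n) F) μ w, φ' (evenElt a) (Ψ μ w) =
    ∑ i, ∑ j, (a i j * (shift i j μ i : F)) • Ψ (shift i j μ) w + Ψ μ (φ (evenElt a) w)
  neg : ∀ μ i, μ i < 0 → Ψ μ = 0
  coord : ∀ ν : Fin n → ℤ, (∀ i, 0 ≤ ν i) → ∑ i, ν i = N →
    ∃ l : R' →ₗ[F] R, ∀ μ, l ∘ₗ Ψ μ = if μ = ν then LinearMap.id else 0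

variable {φ : pn n F →ₗ[F] Module.End F R} {φ' : pn n F →ₗ[F] Module.End F R'} {N : ℕ}
  {Ψ : (Fin n → ℤ) → R →ₗ[F] R'}

theorem isDividedPower_zero (h : IsRep p φ) :
    IsDividedPower p φ φ 0 (fun μ => if μ = 0 then LinearMap.id else 0) where
  isRep := h
  degOne b _ μ w := by split_ifs <;> simp
  even a μ w := by
    have hzero (i j) : (a i j * (shift i j μ i : F)) •
        (if shift i j μ = 0 then (LinearMap.id : R →ₗ[F] R) else 0) w = 0 := by
      split_ifs with h0 <;> simp [h0]
    simp only [hzero, Finset.sum_const_zero, zero_add]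
    split_ifs <;> simp
  neg μ i hi := if_neg fun h0 => by simp [h0] at hi
  coord ν h0 hν := by
    have hν0 : ν = 0 := by
      ext i
      simpa using (Finset.sum_eq_zero_iff_of_nonneg fun i _ => h0 i).1 hν i (Finset.mem_univ i)
    exact ⟨LinearMap.id, fun μ => by rw [hν0, LinearMap.id_comp]⟩

/-- The maps w ↦ ∑ xₗ ⊗ (x^(μ - εₗ) ⊗ w) that make the natural module tensored with the N-th divided
power contain the divided power of degree N + 1. -/
def nextDividedPower (Ψ : (Fin n → ℤ) → R →ₗ[F] R') (μ : Fin n → ℤ) :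
    R →ₗ[F] (Fin n ⊕ Fin n → R') :=
  LinearMap.pi (Sum.elim (fun l => Ψ (μ - Pi.single l 1)) 0)

theorem nextDividedPower_inl (μ : Fin n → ℤ) (w : R) (l : Fin n) :
    nextDividedPower Ψ μ w (.inl l) = Ψ (μ - Pi.single l 1) w := rfl

theorem nextDividedPower_inr (μ : Fin n → ℤ) (w : R) (l : Fin n) :
    nextDividedPower Ψ μ w (.inr l) = 0 := rfl

namespace IsDividedPower

theorem next_degOne (h : IsDividedPower p φ φ' N Ψ) {b : pn n F} (hb : IsDegOne b)
    (μ : Fin n → ℤ) (w : R) :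
    natTensor φ' b (nextDividedPower Ψ μ w) = nextDividedPower Ψ μ (φ b w) := by
  have h11 (i j) : (b : Mat n F) (.inl i) (.inl j) = 0 := congrFun₂ hb.1 i j
  have h21 (i j) : (b : Mat n F) (.inr i) (.inl j) = 0 := congrFun₂ hb.2 i j
  funext c
  rcases c with c | c
  · rw [natTensor_apply_inl φ' hb.hasParity]
    simp [nextDividedPower_inl, nextDividedPower_inr, h11, h.degOne b hb]
  · rw [natTensor_apply_inr φ' hb.hasParity]
    simp [nextDividedPower_inl, nextDividedPower_inr, h21]

theorem sum_shift_sub_single (f : (Fin n → ℤ) → R') (a : Matrix (Fin n) (Fin n) F)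
    (μ : Fin n → ℤ) (c : Fin n) :
    ∑ i, ∑ j, (a i j * (shift i j (μ - Pi.single c 1) i : F)) • f (shift i j (μ - Pi.single c 1)) =
      ∑ i, ∑ j, (a i j * (shift i j μ i : F)) • f (shift i j μ - Pi.single c 1)
        - ∑ j, a c j • f (μ - Pi.single j 1) := by
  have hshift (i j) : shift i j (μ - Pi.single c 1) = shift i j μ - Pi.single c 1 := by
    unfold shift; abel
  have hc (j) : shift c j μ - Pi.single c 1 = μ - Pi.single j 1 := by
    unfold shift; abel
  have hterm (i j) : (a i j * (((shift i j μ - Pi.single c 1 : Fin n → ℤ) i : ℤ) : F)) •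
      f (shift i j μ - Pi.single c 1) = (a i j * (shift i j μ i : F)) •
      f (shift i j μ - Pi.single c 1) - if i = c then a i j • f (μ - Pi.single j 1) else 0 := by
    rcases eq_or_ne i c with rfl | hic
    · simp [mul_sub, sub_smul, hc]
    · simp [hic]
  simp only [hshift, hterm, Finset.sum_sub_distrib]
  rw [Finset.sum_comm (f := fun i j => if i = c then _ else _)]
  simp only [Finset.sum_ite_eq', Finset.mem_univ, if_true]

theorem next_even (h : IsDividedPower p φ φ' N Ψ) (a : Matrix (Fin n) (Fin n) F)
    (μ : Fin n → ℤ) (w : R) : natTensor φ' (evenElt a) (nextDividedPower Ψ μ w) =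
      ∑ i, ∑ j, (a i j * (shift i j μ i : F)) • nextDividedPower Ψ (shift i j μ) w
        + nextDividedPower Ψ μ (φ (evenElt a) w) := by
  funext c
  simp only [Pi.add_apply, Finset.sum_apply, Pi.smul_apply]
  rcases c with c | c
  · rw [natTensor_apply_inl φ' (evenElt_parity a)]
    simp only [Fintype.sum_sum_type, nextDividedPower_inl, nextDividedPower_inr, h.even,
      evenElt_coe, fromBlocks_apply₁₁, smul_zero, Finset.sum_const_zero, add_zero,
      sum_shift_sub_single (fun ν => Ψ ν w) a μ c]
    abel
  · rw [natTensor_apply_inr φ' (evenElt_parity a)]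
    simp [Fintype.sum_sum_type, nextDividedPower_inl, nextDividedPower_inr, evenElt_coe]

theorem next_neg (h : IsDividedPower p φ φ' N Ψ) {μ : Fin n → ℤ} {i : Fin n} (hi : μ i < 0) :
    nextDividedPower Ψ μ = 0 := by
  have hΨ (l) : Ψ (μ - Pi.single l 1) = 0 := by
    refine h.neg _ i ?_
    have : (0 : ℤ) ≤ Pi.single (M := fun _ => ℤ) l 1 i := by
      rw [Pi.single_apply]; split_ifs <;> simp
    rw [Pi.sub_apply]
    lia
  refine LinearMap.ext fun w => funext fun c => ?_
  rcases c with c | c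
  · rw [nextDividedPower_inl, hΨ]; rfl
  · rw [nextDividedPower_inr]; rfl

theorem next_coord (h : IsDividedPower p φ φ' N Ψ) {ν : Fin n → ℤ} (h0 : ∀ i, 0 ≤ ν i)
    (hν : ∑ i, ν i = N + 1) : ∃ l : (Fin n ⊕ Fin n → R') →ₗ[F] R,
      ∀ μ, l ∘ₗ nextDividedPower Ψ μ = if μ = ν then LinearMap.id else 0 := by
  obtain ⟨i, hi⟩ : ∃ i, 0 < ν i := by
    by_contra! hc
    have := Finset.sum_nonpos fun i (_ : i ∈ Finset.univ) => hc i
    lia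
  obtain ⟨f, hf⟩ := h.coord (ν - Pi.single i 1) (fun j => by
    have := h0 j
    rcases eq_or_ne j i with rfl | hj
    · rw [Pi.sub_apply, Pi.single_eq_same]; lia
    · simpa [hj] using this) (by simp [Finset.sum_sub_distrib, hν])
  refine ⟨f ∘ₗ LinearMap.proj (.inl i), fun μ => ?_⟩
  have hcomp : (f ∘ₗ LinearMap.proj (.inl i)) ∘ₗ nextDividedPower Ψ μ =
      f ∘ₗ Ψ (μ - Pi.single i 1) := rfl
  rw [hcomp, hf]
  simp only [sub_left_inj]

theorem next (h : IsDividedPower p φ φ' N Ψ) :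
    IsDividedPower p φ (natTensor φ') (N + 1) (nextDividedPower Ψ) where
  isRep := h.isRep.natTensor
  degOne _ hb := h.next_degOne hb
  even := h.next_even
  neg _ _ := h.next_neg
  coord _ h0 hν := h.next_coord h0 (by exact_mod_cast hν)

end IsDividedPower

theorem IsDividedPower.rootElt_apply (h : IsDividedPower p φ φ' N Ψ) {i j : Fin n} (hij : i ≠ j)
    (μ : Fin n → ℤ) (w : R) : φ' (rootElt F i j) (Ψ μ w) =
      ((μ i + 1 : ℤ) : F) • Ψ (shift i j μ) w + Ψ μ (φ (rootElt F i j) w) := by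
  rw [rootElt, h.even, Fintype.sum_eq_single i, Fintype.sum_eq_single j]
  · simp [shift, hij]
  · intro b hb
    rw [Matrix.single_apply, if_neg (fun hc => hb hc.2.symm), zero_mul, zero_smul]
  · intro b hb
    refine Finset.sum_eq_zero fun c _ => ?_
    rw [Matrix.single_apply, if_neg (fun hc => hb hc.1.symm), zero_mul, zero_smul]

end DividedPowers

section StepWeight

variable {p n : ℕ}

variable (p) in
/-- The exponents p - 1 before position i, r at position i and 0 after it. They are chosen such that
the divided power monomial with these exponents is killed by the positive root vectors. -/
def stepWeight (i : Fin n) (r : ℕ) (l : Fin n) : ℤ :=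
  if l < i then p - 1 else if l = i then r else 0

theorem stepWeight_self (i : Fin n) (r : ℕ) : stepWeight p i r i = r := by
  simp [stepWeight]

theorem stepWeight_of_lt {i l : Fin n} (h : i < l) (r : ℕ) : stepWeight p i r l = 0 := by
  simp [stepWeight, h.not_gt, h.ne']

variable [Fact p.Prime]

theorem stepWeight_nonneg (i : Fin n) (r : ℕ) (l : Fin n) : 0 ≤ stepWeight p i r l := by
  have := (Fact.out : p.Prime).one_lt
  unfold stepWeight; split_ifs <;> lia

theorem exists_sum_stepWeight_eq (i : Fin n) (r : ℕ) :
    ∃ N : ℕ, ∑ l, stepWeight p i r l = N :=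
  Int.eq_ofNat_of_zero_le (Finset.sum_nonneg fun l _ => stepWeight_nonneg i r l)

end StepWeight

section Singular

variable {F : Type*} [Field F] {p : ℕ} [Fact p.Prime] [CharP F p] {n : ℕ}

/-- Nonzero vectors of weight lam killed by the positive root vectors, in a representation of p(n)
or a module over an enveloping algebra of it. -/
structure IsSingular {R : Type*} [AddCommGroup R] [Module F R] (φ : pn n F → Module.End F R)
    (lam : Fin n → ZMod p) (v : R) : Prop where
  ne_zero : v ≠ 0
  pos : ∀ x, IsEvenPos x ∨ IsDegOne x → φ x v = 0
  weight : ∀ x, φ (cartanElt x) v = (∑ i, x i * weightCast F lam i) • v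

variable {R R' : Type*} [AddCommGroup R] [Module F R] [AddCommGroup R'] [Module F R']

theorem map_pow_apply_of_ladder {T : Module.End F R'} {S : Module.End F R} {Ψ : ℕ → R →ₗ[F] R'}
    (hT : ∀ k w, T (Ψ k w) = ((k + 1 : ℕ) : F) • Ψ (k + 1) w + Ψ k (S w)) {l : R' →ₗ[F] R} {j : ℕ}
    (hl : ∀ k, l ∘ₗ Ψ k = if k = j then LinearMap.id else 0) (m k : ℕ) (hmk : m + k ≤ j) (w : R) :
    l ((T ^ m) (Ψ k w)) = if m + k = j then (((k + 1).ascFactorial m : ℕ) : F) • w else 0 := by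
  induction m generalizing k w with
  | zero =>
    rw [pow_zero, Module.End.one_apply, ← LinearMap.comp_apply, hl, zero_add]
    split_ifs <;> simp
  | succ m ih =>
    rw [pow_succ, Module.End.mul_apply, hT, map_add, map_smul, map_add, map_smul,
      ih (k + 1) (by lia), ih k (by lia), if_neg (by lia : m + k ≠ j), add_zero]
    rw [show m + (k + 1) = m + 1 + k by ring, smul_ite, smul_zero, smul_smul, ← Nat.cast_mul,
      Nat.succ_ascFactorial, ← Nat.ascFactorial_succ]

namespace IsDividedPower

variable {φ : pn n F →ₗ[F] Module.End F R} {φ' : pn n F →ₗ[F] Module.End F R'} {N : ℕ}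
  {Ψ : (Fin n → ℤ) → R →ₗ[F] R'}

theorem apply_ne_zero (h : IsDividedPower p φ φ' N Ψ) {ν : Fin n → ℤ} (h0 : ∀ i, 0 ≤ ν i)
    (hν : ∑ i, ν i = N) {v : R} (hv : v ≠ 0) : Ψ ν v ≠ 0 := by
  obtain ⟨l, hl⟩ := h.coord ν h0 hν
  intro hzero
  have := LinearMap.congr_fun (hl ν) v
  rw [if_pos rfl, LinearMap.comp_apply, hzero, map_zero] at this
  exact hv this.symm

theorem evenPos_apply_stepWeight (h : IsDividedPower p φ φ' N Ψ) {x : pn n F} (hx : IsEvenPos x)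
    (i : Fin n) (r : ℕ) (w : R) :
    φ' x (Ψ (stepWeight p i r) w) = Ψ (stepWeight p i r) (φ x w) := by
  rw [eq_evenElt hx.1, h.even, ← eq_evenElt hx.1, add_eq_right]
  refine Finset.sum_eq_zero fun a _ => Finset.sum_eq_zero fun b _ => ?_
  rcases le_or_gt b a with hab | hab
  · rw [hx.2 a b hab, zero_mul, zero_smul]
  rcases lt_or_ge a i with hai | hai
  · have : shift a b (stepWeight p i r) a = p := by
      simp [shift, stepWeight, hai, hab.ne]
    simp [this]
  · rw [h.neg _ b, LinearMap.zero_apply, smul_zero]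
    simp [shift, stepWeight_of_lt (hai.trans_lt hab), hab.ne']

theorem cartanElt_apply (h : IsDividedPower p φ φ' N Ψ) (x : Fin n → F) (μ : Fin n → ℤ) (w : R) :
    φ' (cartanElt x) (Ψ μ w) = (∑ i, x i * (μ i : F)) • Ψ μ w + Ψ μ (φ (cartanElt x) w) := by
  have hterm (a b) : ((diagonal x) a b * (shift a b μ a : F)) • Ψ (shift a b μ) w =
      if a = b then (x a * (μ a : F)) • Ψ μ w else 0 := by
    rcases eq_or_ne a b with rfl | hab
    · simp [shift]
    · simp [hab]
  rw [cartanElt_eq, h.even]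
  simp only [hterm, Finset.sum_ite_eq, Finset.mem_univ, if_true, Finset.sum_smul]

theorem isSingular (h : IsDividedPower p φ φ' N Ψ) {lam : Fin n → ZMod p} {v : R}
    (hv : IsSingular φ lam v) {i : Fin n} {r : ℕ} (hN : ∑ l, stepWeight p i r l = N) :
    IsSingular φ' (fun l => lam l + (stepWeight p i r l : ZMod p)) (Ψ (stepWeight p i r) v) where
  ne_zero := h.apply_ne_zero (stepWeight_nonneg i r) hN hv.ne_zero
  pos x hx := by
    rcases hx with hx | hx
    · rw [h.evenPos_apply_stepWeight hx, hv.pos x (.inl hx), map_zero]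
    · rw [h.degOne x hx, hv.pos x (.inr hx), map_zero]
  weight x := by
    rw [h.cartanElt_apply, hv.weight, map_smul, ← add_smul, ← Finset.sum_add_distrib]
    simp only [weightCast, map_add, map_intCast, mul_add, add_comm]

theorem rootElt_pow_apply_stepWeight_ne_zero (h : IsDividedPower p φ φ' N Ψ) {v : R} (hv : v ≠ 0)
    {i j : Fin n} (hij : i < j) (hN : ∑ l, stepWeight p i (p - 1) l = N) {k : ℕ} (hk : k < p) :
    (φ' (rootElt F j i) ^ k) (Ψ (stepWeight p i (p - 1)) v) ≠ 0 := by
  let ν (a : ℕ) : Fin n → ℤ :=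
    stepWeight p i (p - 1) + Pi.single j (a : ℤ) - Pi.single i (a : ℤ)
  have hνj (a) : ν a j = a := by simp [ν, stepWeight_of_lt hij, hij.ne']
  have hνi (a) : ν a i = (p - 1 : ℕ) - a := by simp [ν, stepWeight_self, hij.ne]
  have hνs (a) : shift j i (ν a) = ν (a + 1) := by
    simp only [ν, shift, Nat.cast_add, Nat.cast_one, Pi.single_add]
    abel
  have hladder (a w) : φ' (rootElt F j i) (Ψ (ν a) w) =
      ((a + 1 : ℕ) : F) • Ψ (ν (a + 1)) w + Ψ (ν a) (φ (rootElt F j i) w) := by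
    rw [h.rootElt_apply hij.ne', hνj, hνs]
    push_cast; rfl
  have hνk (l) : 0 ≤ ν k l := by
    rcases eq_or_ne l j with rfl | hlj
    · rw [hνj]; lia
    rcases eq_or_ne l i with rfl | hli
    · rw [hνi]; lia
    · simpa [ν, hlj, hli] using stepWeight_nonneg i (p - 1) l
  obtain ⟨c, hc⟩ := h.coord (ν k) hνk (by simpa [ν, Finset.sum_sub_distrib, Finset.sum_add_distrib])
  have hcν (a) : c ∘ₗ Ψ (ν a) = if a = k then LinearMap.id else 0 := by
    have : ν a = ν k ↔ a = k :=
      ⟨fun e => by simpa [hνj] using congrFun e j, fun e => by rw [e]⟩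
    simp only [hc, this]
  have hval := map_pow_apply_of_ladder hladder hcν k 0 le_rfl v
  rw [if_pos (add_zero k), zero_add, Nat.one_ascFactorial] at hval
  have hν0 : ν 0 = stepWeight p i (p - 1) := by simp [ν]
  rw [hν0] at hval
  intro hzero
  rw [hzero, map_zero, eq_comm, smul_eq_zero, or_iff_left hv, CharP.cast_eq_zero_iff F p,
    (Fact.out : p.Prime).dvd_factorial] at hval
  lia

end IsDividedPower

end Singular

section SingularExistence

universe u v

variable {F : Type u} [Field F] {p : ℕ} [Fact p.Prime] [CharP F p] {n : ℕ}

theorem exists_isDividedPower {R : Type v} [AddCommGroup R] [Module F R]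
    {φ : pn n F →ₗ[F] Module.End F R} (h : IsRep p φ) (N : ℕ) :
    ∃ (R' : Type v) (_ : AddCommGroup R') (_ : Module F R') (φ' : pn n F →ₗ[F] Module.End F R')
      (Ψ : (Fin n → ℤ) → R →ₗ[F] R'), IsDividedPower p φ φ' N Ψ := by
  induction N with
  | zero => exact ⟨R, _, _, φ, _, isDividedPower_zero h⟩
  | succ N ih =>
    obtain ⟨R', _, _, φ', Ψ, hΨ⟩ := ih
    exact ⟨_, _, _, _, _, hΨ.next⟩

variable (F) in
/-- Some representation over F has a singular vector of weight lam. -/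
def HasSingular (lam : Fin n → ZMod p) : Prop :=
  ∃ (R : Type u) (_ : AddCommGroup R) (_ : Module F R) (φ : pn n F →ₗ[F] Module.End F R) (v : R),
    IsRep p φ ∧ IsSingular φ lam v

theorem HasSingular.add_stepWeight {lam : Fin n → ZMod p} (h : HasSingular F lam) (i : Fin n)
    (r : ℕ) : HasSingular F fun l => lam l + (stepWeight p i r l : ZMod p) := by
  obtain ⟨R, _, _, φ, v, hφ, hv⟩ := h
  obtain ⟨N, hN⟩ := exists_sum_stepWeight_eq (p := p) i r
  obtain ⟨R', _, _, φ', Ψ, hΨ⟩ := exists_isDividedPower hφ N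
  exact ⟨R', _, _, φ', _, hΨ.isRep, hΨ.isSingular hv hN⟩

variable (F p n) in
theorem hasSingular_zero : HasSingular F (0 : Fin n → ZMod p) := by
  refine ⟨F, _, _, 0, 1, ⟨?_, ?_⟩, one_ne_zero, ?_, ?_⟩
  · intros; simp
  · intros; simp [(Fact.out : p.Prime).ne_zero]
  · intros; simp
  · intros; simp [weightCast]

variable (F) in
theorem hasSingular (lam : Fin n → ZMod p) : HasSingular F lam := by
  suffices h : ∀ k ≤ n, ∀ lam : Fin n → ZMod p, (∀ l : Fin n, k ≤ l → lam l = 0) →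
      HasSingular F lam from h n le_rfl lam fun l hl => absurd l.2 hl.not_gt
  intro k
  induction k with
  | zero =>
    intro _ lam h0
    rw [funext fun l => h0 l (Nat.zero_le _)]
    exact hasSingular_zero F p n
  | succ k ih =>
    intro hk lam h0
    let i : Fin n := ⟨k, hk⟩
    let r := (lam i).val
    have hprev : HasSingular F fun l => lam l - (stepWeight p i r l : ZMod p) := by
      refine ih (by lia) _ fun l hl => ?_
      rcases (show i ≤ l from hl).eq_or_lt with rfl | hil
      · rw [stepWeight_self, Int.cast_natCast, ZMod.natCast_zmod_val, sub_self]
      · rw [stepWeight_of_lt hil, h0 l hil, Int.cast_zero, sub_zero]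
    simpa only [sub_add_cancel] using hprev.add_stepWeight i r

variable (F) in
theorem exists_isSingular_rootElt_pow_ne_zero (lam : Fin n → ZMod p) {i j : Fin n} (hij : i < j) :
    ∃ (R : Type u) (_ : AddCommGroup R) (_ : Module F R) (φ : pn n F →ₗ[F] Module.End F R) (v : R),
      IsRep p φ ∧ IsSingular φ lam v ∧ ∀ k < p, (φ (rootElt F j i) ^ k) v ≠ 0 := by
  obtain ⟨R, _, _, φ, v, hφ, hv⟩ :=
    hasSingular F fun l => lam l - (stepWeight p i (p - 1) l : ZMod p)
  obtain ⟨N, hN⟩ := exists_sum_stepWeight_eq (p := p) i (p - 1)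
  obtain ⟨R', _, _, φ', Ψ, hΨ⟩ := exists_isDividedPower hφ N
  refine ⟨R', _, _, φ', _, hΨ.isRep, ?_, fun k hk =>
    hΨ.rootElt_pow_apply_stepWeight_ne_zero hv.ne_zero hij hN hk⟩
  simpa only [sub_add_cancel] using hΨ.isSingular hv hN

end SingularExistence

section Extension

variable {F : Type*} [Field F] {p : ℕ} [Fact p.Prime] [CharP F p] {n : ℕ}
  {A : Type*} [Ring A] [Algebra F A] {φ : pn n F →ₗ[F] A}

namespace IsRep

theorem lift_rel (h : IsRep p φ) ⦃a b : TensorAlgebra F (pn n F)⦄ (hab : URel F p n a b) :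
    TensorAlgebra.lift F φ a = TensorAlgebra.lift F φ b := by
  cases hab with
  | bracket i j x y hx hy => simpa using h.bracket i j x y hx hy
  | pPower x hx => simpa using h.pPower x hx

/-- The extension of a representation of p(n) to its restricted enveloping superalgebra. -/
def liftU (h : IsRep p φ) : U F p n →ₐ[F] A :=
  RingQuot.liftAlgHom F ⟨TensorAlgebra.lift F φ, h.lift_rel⟩

theorem liftU_ιU (h : IsRep p φ) (x : pn n F) : h.liftU (ιU F p n x) = φ x := by
  have e := RingQuot.liftAlgHom_mkAlgHom_apply F (s := URel F p n)
    (TensorAlgebra.lift F φ) h.lift_rel (TensorAlgebra.ι F x)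
  rw [TensorAlgebra.lift_ι_apply] at e
  exact e

theorem liftU_rel (h : IsRep p φ) (hd : ∀ l : List (pn n F), (∀ x ∈ l, IsDegOne x) →
    n * (n - 1) / 2 < l.length → (l.map φ).prod = 0) ⦃a b : U F p n⦄ (hab : IRel F p n a b) :
    h.liftU a = h.liftU b := by
  cases hab with
  | mk l hl hk =>
    rw [map_zero, map_list_prod, List.map_map, ← hd l hl hk]
    congr 1
    exact List.map_congr_left fun x _ => h.liftU_ιU x

theorem exists_lift (h : IsRep p φ) (hd : ∀ l : List (pn n F), (∀ x ∈ l, IsDegOne x) →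
    n * (n - 1) / 2 < l.length → (l.map φ).prod = 0) :
    ∃ Φ : Ubar F p n →ₐ[F] A, ∀ x, Φ (ι F p n x) = φ x := by
  refine ⟨RingQuot.liftAlgHom F ⟨h.liftU, h.liftU_rel hd⟩, fun x => ?_⟩
  have e := RingQuot.liftAlgHom_mkAlgHom_apply F (s := IRel F p n) h.liftU (h.liftU_rel hd)
    (ιU F p n x)
  rw [h.liftU_ιU] at e
  exact e

end IsRep

end Extension

section SquareZero

theorem prod_map_eq_zero_of_finrank_lt {F M A : Type*} [Field F] [AddCommGroup M] [Module F M]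
    [Module.Finite F M] [Ring A] [Algebra F A] {f : M →ₗ[F] A} (hf : ∀ m, f m * f m = 0)
    {l : List M} (hl : Module.finrank F M < l.length) : (l.map f).prod = 0 := by
  have hdep : ¬ LinearIndependent F l.get := fun hli => by
    have := hli.fintype_card_le_finrank
    rw [Fintype.card_fin] at this
    exact this.not_gt hl
  have hzero := congrArg (ExteriorAlgebra.lift F ⟨f, hf⟩)
    ((ExteriorAlgebra.ιMulti F l.length).map_linearDependent l.get hdep)
  rw [ExteriorAlgebra.ιMulti_apply, map_zero, map_list_prod, List.map_ofFn] at hzero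
  rw [← hzero]
  congr 1
  refine List.ext_get (by simp) fun i _ _ => ?_
  simp [ExteriorAlgebra.lift_ι_apply]

end SquareZero

section DegNeg

variable {F : Type*} [Field F] {n : ℕ}

variable (n F) in
/-- The component of p(n) of ℤ-degree -1, where a = b = 0. -/
def degNeg : Submodule F (pn n F) where
  carrier := {x | (x : Mat n F).toBlocks₁₁ = 0 ∧ (x : Mat n F).toBlocks₁₂ = 0}
  zero_mem' := ⟨rfl, rfl⟩
  add_mem' {x y} hx hy := by
    constructor
    · change (x : Mat n F).toBlocks₁₁ + (y : Mat n F).toBlocks₁₁ = 0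
      rw [hx.1, hy.1, add_zero]
    · change (x : Mat n F).toBlocks₁₂ + (y : Mat n F).toBlocks₁₂ = 0
      rw [hx.2, hy.2, add_zero]
  smul_mem' r x hx := by
    constructor
    · change r • (x : Mat n F).toBlocks₁₁ = 0
      rw [hx.1, smul_zero]
    · change r • (x : Mat n F).toBlocks₁₂ = 0
      rw [hx.2, smul_zero]

theorem degNeg_parity {x : pn n F} (hx : x ∈ degNeg F n) : HasParity 1 x := hx.1

theorem bracket_degNeg_degNeg {x y : pn n F} (hx : x ∈ degNeg F n) (hy : y ∈ degNeg F n) :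
    bracket x y = 0 := by
  ext1
  rw [bracket_coe (degNeg_parity hx) (degNeg_parity hy)]
  obtain ⟨x, a, b, c, hb, hc, rfl⟩ := x
  obtain ⟨y, a', b', c', hb', hc', rfl⟩ := y
  obtain ⟨h1, h2⟩ := hx
  obtain ⟨h3, h4⟩ := hy
  simp_all [fromBlocks_multiply]

theorem bracket_even_degNeg {x y : pn n F} (hx : HasParity 0 x) (hy : y ∈ degNeg F n) :
    bracket x y ∈ degNeg F n := by
  refine ⟨?_, ?_⟩ <;> rw [bracket_coe hx (degNeg_parity hy)] <;>
  · obtain ⟨x, a, b, c, hb, hc, rfl⟩ := x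
    obtain ⟨y, a', b', c', hb', hc', rfl⟩ := y
    obtain ⟨h3, h4⟩ := hy
    simp_all [HasParity, koszul, fromBlocks_multiply, sub_eq_add_neg, fromBlocks_neg,
      fromBlocks_add]

theorem bracket_degOne_even {x y : pn n F} (hx : IsDegOne x) (hy : HasParity 0 y) :
    IsDegOne (bracket x y) := by
  refine ⟨?_, ?_⟩ <;> rw [bracket_coe hx.hasParity hy] <;>
  · obtain ⟨x, a, b, c, hb, hc, rfl⟩ := x
    obtain ⟨y, a', b', c', hb', hc', rfl⟩ := y
    obtain ⟨h3, h4⟩ := hx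
    simp_all [HasParity, koszul, fromBlocks_multiply, sub_eq_add_neg, fromBlocks_neg,
      fromBlocks_add]

theorem exists_degree_decomposition (x : pn n F) :
    ∃ y z w : pn n F, HasParity 0 y ∧ IsDegOne z ∧ w ∈ degNeg F n ∧ x = y + z + w := by
  obtain ⟨x, a, b, c, hb, hc, rfl⟩ := x
  refine ⟨evenElt a, ⟨fromBlocks 0 b 0 0, 0, b, 0, hb, by simp, by simp⟩,
    ⟨fromBlocks 0 0 c 0, 0, 0, c, by simp, hc, by simp⟩, evenElt_parity a,
    ⟨by simp, by simp⟩, ⟨by simp, by simp⟩, ?_⟩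
  ext1
  change _ = fromBlocks a 0 0 (-aᵀ) + fromBlocks 0 b 0 0 + fromBlocks 0 0 c 0
  simp [fromBlocks_add]

theorem finrank_degNeg_le (h2 : (2 : F) ≠ 0) :
    Module.finrank F (degNeg F n) ≤ n * (n - 1) / 2 := by
  let f : degNeg F n →ₗ[F] ((Σ i : Fin n, Fin i) → F) :=
    { toFun := fun x q => (x : Mat n F) (.inr q.1) (.inl ⟨q.2, q.2.2.trans q.1.2⟩)
      map_add' := fun _ _ => rfl
      map_smul' := fun _ _ => rfl }
  have hf : Function.Injective f := by
    rw [injective_iff_map_eq_zero]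
    rintro ⟨⟨x, a, b, c, hb, hc, rfl⟩, h11, h12⟩ h0
    simp only [toBlocks_fromBlocks₁₁, toBlocks_fromBlocks₁₂] at h11 h12
    have hlt : ∀ i j : Fin n, j < i → c i j = 0 := fun i j hij => congrFun h0 ⟨i, ⟨j, hij⟩⟩
    have hcs : ∀ i j, c i j = - c j i := fun i j => by
      have := congrFun₂ hc j i
      simpa using this
    have : c = 0 := by
      ext i j
      rcases lt_trichotomy i j with h | rfl | h
      · rw [hcs, hlt _ _ h]; simp
      · have := hcs i i
        rw [eq_neg_iff_add_eq_zero, ← two_mul] at this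
        exact (mul_eq_zero.1 this).resolve_left h2
      · exact hlt _ _ h
    ext1; ext1
    simp [h11, h12, this]
  refine (LinearMap.finrank_le_finrank_of_injective hf).trans (le_of_eq ?_)
  rw [Module.finrank_fintype_fun_eq_card, Fintype.card_sigma]
  simp only [Fintype.card_fin]
  rw [Fin.sum_univ_eq_sum_range (fun i => i) n, Finset.sum_range_id]

end DegNeg

section Restriction

variable {F : Type*} [Field F] {n : ℕ} {R : Type*} [AddCommGroup R] [Module F R]
  {φ : pn n F →ₗ[F] Module.End F R}

/-- The restriction of a representation to a stable subspace. -/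
def restrictRep (φ : pn n F →ₗ[F] Module.End F R) (Y : Submodule F R)
    (hY : ∀ x, ∀ u ∈ Y, φ x u ∈ Y) : pn n F →ₗ[F] Module.End F Y where
  toFun x := (φ x).restrict (hY x)
  map_add' _ _ := by ext; simp only [map_add, LinearMap.restrict_apply, LinearMap.add_apply,
    Submodule.coe_add]
  map_smul' _ _ := by ext; simp only [map_smul, LinearMap.restrict_apply, LinearMap.smul_apply,
    Submodule.coe_smul, RingHom.id_apply]

variable {Y : Submodule F R} (hY : ∀ x, ∀ u ∈ Y, φ x u ∈ Y)

theorem restrictRep_coe (x : pn n F) (u : Y) : (restrictRep φ Y hY x u : R) = φ x u := rfl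

theorem restrictRep_pow_coe (x : pn n F) (k : ℕ) (u : Y) :
    ((restrictRep φ Y hY x ^ k) u : R) = (φ x ^ k) u := by
  induction k with
  | zero => rfl
  | succ k ih => rw [pow_succ', pow_succ', Module.End.mul_apply, restrictRep_coe, ih]; rfl

theorem restrictRep_list_coe (l : List (pn n F)) (u : Y) :
    (((l.map (restrictRep φ Y hY)).prod u : Y) : R) = (l.map φ).prod u := by
  induction l with
  | nil => rfl
  | cons x l ih =>
    rw [List.map_cons, List.prod_cons, Module.End.mul_apply, restrictRep_coe, ih]; rfl

theorem IsRep.restrict {p : ℕ} [Fact p.Prime] [CharP F p] (h : IsRep p φ) :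
    IsRep p (restrictRep φ Y hY) where
  bracket i j x y hx hy := by
    ext u
    have := LinearMap.congr_fun (h.bracket i j x y hx hy) u
    simpa [restrictRep_coe] using this
  pPower x hx := by
    ext u
    rw [restrictRep_pow_coe, h.pPower, restrictRep_coe]

theorem IsSingular.restrict {p : ℕ} [CharP F p] {lam : Fin n → ZMod p} {v : R}
    (h : IsSingular φ lam v) (hv : v ∈ Y) : IsSingular (restrictRep φ Y hY) lam ⟨v, hv⟩ where
  ne_zero h0 := h.ne_zero (congrArg Subtype.val h0)
  pos x hx := Subtype.ext (h.pos x hx)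
  weight x := Subtype.ext (h.weight x)

end Restriction

section Truncation

variable {F : Type*} [Field F] {p : ℕ} [Fact p.Prime] [CharP F p] {n : ℕ}
  {R : Type*} [AddCommGroup R] [Module F R] {φ : pn n F →ₗ[F] Module.End F R}

theorem IsRep.swap (h : IsRep p φ) {i j : ZMod 2} {x y : pn n F} (hx : HasParity i x)
    (hy : HasParity j y) (v : R) :
    φ x (φ y v) = koszul F i j • φ y (φ x v) + φ (Periplectic.bracket x y) v := by
  have := LinearMap.congr_fun (h.bracket i j x y hx hy) v
  rw [← this]
  simp

theorem IsRep.degNeg_prod_eq_zero (h : IsRep p φ) (h2 : (2 : F) ≠ 0) {l : List (pn n F)}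
    (hl : ∀ x ∈ l, x ∈ degNeg F n) (hlen : n * (n - 1) / 2 < l.length) : (l.map φ).prod = 0 := by
  lift l to List (degNeg F n) using hl
  rw [List.length_map] at hlen
  rw [List.map_map]
  refine prod_map_eq_zero_of_finrank_lt (F := F) (M := degNeg F n) (A := Module.End F R)
    (f := φ ∘ₗ (degNeg F n).subtype) (fun c => ?_) ((finrank_degNeg_le h2).trans_lt hlen)
  change φ c * φ c = 0
  have hc := h.bracket 1 1 c c (degNeg_parity c.2) (degNeg_parity c.2)
  rw [bracket_degNeg_degNeg c.2 c.2, map_zero] at hc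
  simp only [koszul, and_self, if_true, neg_smul, one_smul, sub_neg_eq_add] at hc
  rw [← two_smul F, smul_eq_zero] at hc
  exact hc.resolve_left h2

/-- The vectors killed by the elements of degree 1. -/
def topSpace (φ : pn n F →ₗ[F] Module.End F R) : Submodule F R where
  carrier := {w | ∀ b, IsDegOne b → φ b w = 0}
  zero_mem' := fun b _ => map_zero _
  add_mem' := fun hx hy b hb => by rw [map_add, hx b hb, hy b hb, add_zero]
  smul_mem' := fun r x hx b hb => by rw [map_smul, hx b hb, smul_zero]

/-- The span of the products of fewer than k elements of degree -1, applied to `topSpace φ`. -/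
def lowerSpace (φ : pn n F →ₗ[F] Module.End F R) (k : ℕ) : Submodule F R :=
  Submodule.span F {u | ∃ (l : List (pn n F)) (w : R), (∀ x ∈ l, x ∈ degNeg F n) ∧
    l.length < k ∧ w ∈ topSpace φ ∧ u = (l.map φ).prod w}

theorem lowerSpace_zero : lowerSpace φ 0 = ⊥ := by
  rw [lowerSpace, Submodule.span_eq_bot]
  rintro _ ⟨l, w, -, hl, -⟩
  exact absurd hl (Nat.not_lt_zero _)

theorem topSpace_le {k : ℕ} (hk : 0 < k) : topSpace φ ≤ lowerSpace φ k := fun w hw =>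
  Submodule.subset_span ⟨[], w, by simp, hk, hw, by simp⟩

theorem lowerSpace_mono {k k' : ℕ} (hk : k ≤ k') : lowerSpace φ k ≤ lowerSpace φ k' :=
  Submodule.span_mono fun _ ⟨l, w, h1, h2, h3⟩ => ⟨l, w, h1, h2.trans_le hk, h3⟩

theorem degNeg_lowerSpace {k : ℕ} {c : pn n F} (hc : c ∈ degNeg F n) :
    ∀ u ∈ lowerSpace φ k, φ c u ∈ lowerSpace φ (k + 1) := by
  change lowerSpace φ k ≤ (lowerSpace φ (k + 1)).comap (φ c)
  refine Submodule.span_le.2 ?_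
  rintro _ ⟨l, w, hl, hk, hw, rfl⟩
  exact Submodule.subset_span
    ⟨c :: l, w, List.forall_mem_cons.2 ⟨hc, hl⟩, by simpa using hk, hw, by simp⟩

theorem IsRep.even_topSpace (h : IsRep p φ) {a : pn n F} (ha : HasParity 0 a) {w : R}
    (hw : w ∈ topSpace φ) : φ a w ∈ topSpace φ := fun b hb => by
  rw [h.swap hb.hasParity ha, hw b hb, hw _ (bracket_degOne_even hb ha), map_zero, smul_zero,
    add_zero]

theorem IsRep.even_prod (h : IsRep p φ) {l : List (pn n F)} (hl : ∀ x ∈ l, x ∈ degNeg F n)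
    {w : R} (hw : w ∈ topSpace φ) {a : pn n F} (ha : HasParity 0 a) :
    φ a ((l.map φ).prod w) ∈ lowerSpace φ (l.length + 1) := by
  induction l with
  | nil => exact topSpace_le (by simp) (h.even_topSpace ha hw)
  | cons c l ih =>
    have hc : c ∈ degNeg F n := hl c (by simp)
    have hl' : ∀ x ∈ l, x ∈ degNeg F n := fun x hx => hl x (by simp [hx])
    rw [List.map_cons, List.prod_cons, Module.End.mul_apply, h.swap ha (degNeg_parity hc)]
    refine add_mem (Submodule.smul_mem _ _ (degNeg_lowerSpace hc _ (ih hl'))) ?_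
    exact degNeg_lowerSpace (bracket_even_degNeg ha hc) _
      (Submodule.subset_span ⟨l, w, hl', by simp, hw, rfl⟩)

theorem IsRep.even_lowerSpace (h : IsRep p φ) {k : ℕ} {a : pn n F} (ha : HasParity 0 a) :
    ∀ u ∈ lowerSpace φ k, φ a u ∈ lowerSpace φ k := by
  change lowerSpace φ k ≤ (lowerSpace φ k).comap (φ a)
  refine Submodule.span_le.2 ?_
  rintro _ ⟨l, w, hl, hk, hw, rfl⟩
  exact lowerSpace_mono hk (h.even_prod hl hw ha)

theorem IsRep.degOne_prod (h : IsRep p φ) {l : List (pn n F)} (hl : ∀ x ∈ l, x ∈ degNeg F n)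
    {w : R} (hw : w ∈ topSpace φ) {b : pn n F} (hb : IsDegOne b) :
    φ b ((l.map φ).prod w) ∈ lowerSpace φ l.length := by
  induction l with
  | nil => simp [hw b hb]
  | cons c l ih =>
    have hc : c ∈ degNeg F n := hl c (by simp)
    have hl' : ∀ x ∈ l, x ∈ degNeg F n := fun x hx => hl x (by simp [hx])
    rw [List.map_cons, List.prod_cons, Module.End.mul_apply, h.swap hb.hasParity (degNeg_parity hc)]
    refine add_mem (Submodule.smul_mem _ _ (degNeg_lowerSpace hc _ (ih hl'))) ?_
    exact h.even_prod hl' hw (hb.hasParity.bracket (degNeg_parity hc))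

theorem IsRep.degOne_lowerSpace (h : IsRep p φ) {k : ℕ} {b : pn n F} (hb : IsDegOne b) :
    ∀ u ∈ lowerSpace φ (k + 1), φ b u ∈ lowerSpace φ k := by
  change lowerSpace φ (k + 1) ≤ (lowerSpace φ k).comap (φ b)
  refine Submodule.span_le.2 ?_
  rintro _ ⟨l, w, hl, hk, hw, rfl⟩
  exact lowerSpace_mono (Nat.lt_succ_iff.1 hk) (h.degOne_prod hl hw hb)

theorem IsRep.degOne_list (h : IsRep p φ) {l : List (pn n F)} (hl : ∀ x ∈ l, IsDegOne x) {k : ℕ}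
    {u : R} (hu : u ∈ lowerSpace φ k) : (l.map φ).prod u ∈ lowerSpace φ (k - l.length) := by
  induction l with
  | nil => simpa using hu
  | cons b l ih =>
    have hb := hl b (by simp)
    have ih := ih fun x hx => hl x (by simp [hx])
    rw [List.map_cons, List.prod_cons, Module.End.mul_apply, List.length_cons]
    rcases Nat.eq_zero_or_pos (k - l.length) with h0 | h0
    · rw [h0, lowerSpace_zero, Submodule.mem_bot] at ih
      rw [ih, map_zero]
      exact zero_mem _
    · refine h.degOne_lowerSpace hb _ ?_
      convert ih using 2
      omega

theorem IsRep.lowerSpace_stable (h : IsRep p φ) (h2 : (2 : F) ≠ 0) (x : pn n F) :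
    ∀ u ∈ lowerSpace φ (n * (n - 1) / 2 + 1), φ x u ∈ lowerSpace φ (n * (n - 1) / 2 + 1) := by
  intro u hu
  obtain ⟨y, z, w, hy, hz, hw, rfl⟩ := exists_degree_decomposition x
  rw [map_add, map_add]
  refine add_mem (add_mem (h.even_lowerSpace hy u hu)
    (lowerSpace_mono (Nat.le_succ _) (h.degOne_lowerSpace hz u hu))) ?_
  have h3 := degNeg_lowerSpace hw u hu
  suffices hle : lowerSpace φ (n * (n - 1) / 2 + 1 + 1) ≤ lowerSpace φ (n * (n - 1) / 2 + 1) from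
    hle h3
  refine Submodule.span_le.2 ?_
  rintro _ ⟨l, w, hl, -, hw, rfl⟩
  rcases lt_or_ge (n * (n - 1) / 2) l.length with h4 | h4
  · rw [h.degNeg_prod_eq_zero h2 hl h4]
    exact zero_mem _
  · exact Submodule.subset_span ⟨l, w, hl, Nat.lt_succ_of_le h4, hw, rfl⟩

theorem IsRep.restrict_lowerSpace_degOne (h : IsRep p φ)
    (hY : ∀ x, ∀ u ∈ lowerSpace φ (n * (n - 1) / 2 + 1), φ x u ∈ lowerSpace φ (n * (n - 1) / 2 + 1))
    {l : List (pn n F)} (hl : ∀ x ∈ l, IsDegOne x) (hlen : n * (n - 1) / 2 < l.length) :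
    (l.map (restrictRep φ _ hY)).prod = 0 := by
  ext u
  have hu := h.degOne_list hl u.2
  rw [Nat.sub_eq_zero_of_le hlen, lowerSpace_zero, Submodule.mem_bot] at hu
  rw [restrictRep_list_coe, hu]; rfl

/-- A singular vector survives in the submodule spanned by its images under products of at most
n(n-1)/2 elements of degree -1, on which ū acts. -/
theorem IsSingular.exists_ubar (h2 : (2 : F) ≠ 0) (hφ : IsRep p φ) {lam : Fin n → ZMod p} {v : R}
    (hv : IsSingular φ lam v) :
    ∃ (Y : Submodule F R) (Φ : Ubar F p n →ₐ[F] Module.End F Y) (v' : Y),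
      IsSingular (fun x => Φ (ι F p n x)) lam v' ∧
        ∀ x k, (((Φ (ι F p n x) ^ k) v' : Y) : R) = (φ x ^ k) v := by
  have hY := hφ.lowerSpace_stable h2
  obtain ⟨Φ, hΦ⟩ := (hφ.restrict hY).exists_lift fun l => hφ.restrict_lowerSpace_degOne hY
  have hvY := topSpace_le (n * (n - 1) / 2).succ_pos fun b hb => hv.pos b (.inr hb)
  refine ⟨_, Φ, ⟨v, hvY⟩, ?_, fun x k => ?_⟩
  · simpa only [hΦ] using hv.restrict hY hvY
  · rw [hΦ, restrictRep_pow_coe]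

end Truncation

section RootVectors

variable {F : Type*} [Field F] {n : ℕ}

/-- A one-parameter subgroup of the diagonal torus under which all negative roots of p(n) have
positive degree. -/
def gradingTorus (n : ℕ) (t : Fˣ) : GL (Fin n) F where
  val := diagonal fun i => ((t⁻¹ ^ (n - i : ℕ) : Fˣ) : F)
  inv := diagonal fun i => ((t ^ (n - i : ℕ) : Fˣ) : F)
  val_inv := by simp
  inv_val := by simp

theorem gradingTorus_isDiag (t : Fˣ) : (gradingTorus n t : Matrix (Fin n) (Fin n) F).IsDiag :=
  isDiag_diagonal _

theorem gradingTorus_coe (t : Fˣ) : (gradingTorus n t : Matrix (Fin n) (Fin n) F) =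
    diagonal fun i : Fin n => ((t⁻¹ ^ (n - i : ℕ) : Fˣ) : F) := rfl

theorem gradingTorus_inv_coe (t : Fˣ) : ((gradingTorus n t)⁻¹ : GL (Fin n) F).1 =
    diagonal fun i : Fin n => ((t ^ (n - i : ℕ) : Fˣ) : F) := rfl

variable (F n) in
/-- Homogeneous elements of p(n) of positive degree under the grading torus. They include the
negative root vectors. -/
def IsNegRoot (y : pn n F) : Prop :=
  (∃ i, HasParity i y) ∧ ∃ r : ℕ, 0 < r ∧
    ∀ t : Fˣ, Ad (gradingTorus n t) y = ((t ^ r : Fˣ) : F) • y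

variable (F) in
/-- The root vector of the root -εᵢ - εⱼ of the odd part. -/
def lowElt (i j : Fin n) : pn n F :=
  ⟨fromBlocks 0 0 (Matrix.single i j 1 - Matrix.single j i 1) 0,
    ⟨0, 0, Matrix.single i j 1 - Matrix.single j i 1, by simp, by simp, by simp⟩⟩

theorem lowElt_coe (i j : Fin n) : (lowElt F i j : Mat n F) =
    fromBlocks 0 0 (Matrix.single i j 1 - Matrix.single j i 1) 0 := rfl

theorem Ad_evenElt (g : GL (Fin n) F) (a : Matrix (Fin n) (Fin n) F) :
    Ad g (evenElt a) = evenElt (g.1 * a * (g⁻¹).1) := by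
  rw [eq_evenElt (Ad_parity g (evenElt_parity a)), Ad_blocks, toBlocks_fromBlocks₁₁, evenElt_coe,
    toBlocks_fromBlocks₁₁]

theorem diagonal_mul_single_mul_diagonal (d e : Fin n → F) (i j : Fin n) (c : F) :
    diagonal d * Matrix.single i j c * diagonal e = Matrix.single i j (d i * c * e j) := by
  ext k l
  rw [mul_diagonal, diagonal_mul, single_apply, single_apply]
  split_ifs with h
  · rw [h.1, h.2]
  · rw [mul_zero, zero_mul]

theorem isNegRoot_rootElt {i j : Fin n} (hij : i < j) : IsNegRoot F n (rootElt F j i) := by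
  refine ⟨⟨0, rootElt_parity j i⟩, j - i, by omega, fun t => ?_⟩
  have ht : t⁻¹ ^ (n - j : ℕ) * t ^ (n - i : ℕ) = t ^ (j - i : ℕ) := by
    rw [inv_pow, inv_mul_eq_iff_eq_mul, ← pow_add]
    congr 1
    omega
  rw [rootElt, Ad_evenElt, gradingTorus_coe, gradingTorus_inv_coe,
    diagonal_mul_single_mul_diagonal, ← map_smul, smul_single, mul_one, smul_eq_mul, mul_one,
    ← Units.val_mul, ht]

theorem isNegRoot_lowElt (i j : Fin n) : IsNegRoot F n (lowElt F i j) := by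
  refine ⟨⟨1, by simp [HasParity, lowElt_coe]⟩, (n - i) + (n - j), by omega, fun t => ?_⟩
  ext1
  rw [Ad_blocks, gradingTorus_inv_coe, Submodule.coe_smul, lowElt_coe]
  simp only [toBlocks_fromBlocks₁₁, toBlocks_fromBlocks₁₂, toBlocks_fromBlocks₂₁,
    toBlocks_fromBlocks₂₂, Matrix.mul_zero, Matrix.zero_mul, fromBlocks_smul, smul_zero,
    diagonal_transpose, Matrix.mul_sub, Matrix.sub_mul, diagonal_mul_single_mul_diagonal,
    smul_sub, smul_single, pow_add, Units.val_mul, mul_one, smul_eq_mul, mul_comm]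

theorem isEvenPos_rootElt {i j : Fin n} (hij : i < j) : IsEvenPos (rootElt F i j) := by
  refine ⟨rootElt_parity i j, fun a b hab => ?_⟩
  rw [rootElt, evenElt_coe, toBlocks_fromBlocks₁₁, single_apply_of_ne]
  rintro ⟨rfl, rfl⟩
  exact hab.not_gt hij

theorem rootElt_self (i : Fin n) : rootElt F i i = cartanElt (Pi.single i 1) := by
  rw [rootElt, cartanElt_eq, diagonal_single]

theorem eq_sum_rootElt {x : pn n F} (hx : HasParity 0 x) :
    x = ∑ i, ∑ j, (x : Mat n F).toBlocks₁₁ i j • rootElt F i j := by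
  conv_lhs => rw [eq_evenElt hx, matrix_eq_sum_single (x : Mat n F).toBlocks₁₁]
  simp only [map_sum, rootElt, ← map_smul, smul_single, smul_eq_mul, mul_one]

theorem eq_sum_lowElt (h2 : (2 : F) ≠ 0) {x : pn n F} (hx : x ∈ degNeg F n) :
    x = ∑ i, ∑ j, ((x : Mat n F).toBlocks₂₁ i j / 2) • lowElt F i j := by
  obtain ⟨x, a, b, c, hb, hc, rfl⟩ := x
  obtain ⟨ha : a = 0, hb : b = 0⟩ := hx
  have hc' (i j : Fin n) : c j i = -c i j := congrFun₂ hc i j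
  have key : c = ∑ i, ∑ j, (c i j / 2) • (Matrix.single i j 1 - Matrix.single j i 1) := by
    ext k l
    simp only [Matrix.sum_apply, Matrix.smul_apply, Matrix.sub_apply, single_apply, smul_eq_mul,
      mul_sub, mul_ite, mul_one, mul_zero, Finset.sum_sub_distrib, ite_and, Finset.sum_ite_eq',
      Finset.mem_univ, if_true, Finset.sum_ite_irrel, Finset.sum_const_zero, hc' k l]
    field_simp
    ring
  subst ha hb
  ext (k | k) (l | l)
  case inr.inl =>
    simpa [Matrix.sum_apply, lowElt_coe] using congrFun₂ key k l
  all_goals simp [Matrix.sum_apply, lowElt_coe]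

theorem span_triangularSet_eq_top (h2 : (2 : F) ≠ 0) :
    Submodule.span F ({x : pn n F | IsEvenPos x ∨ IsDegOne x} ∪ {y | IsNegRoot F n y} ∪
      Set.range cartanElt) = ⊤ := by
  refine eq_top_iff.2 fun x _ => ?_
  obtain ⟨y, z, w, hy, hz, hw, rfl⟩ := exists_degree_decomposition x
  refine add_mem (add_mem ?_ (Submodule.subset_span (.inl (.inl (.inr hz))))) ?_
  · rw [eq_sum_rootElt hy]
    refine sum_mem fun i _ => sum_mem fun j _ => Submodule.smul_mem _ _ (Submodule.subset_span ?_)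
    rcases lt_trichotomy i j with hij | rfl | hij
    · exact .inl (.inl (.inl (isEvenPos_rootElt hij)))
    · exact .inr ⟨_, (rootElt_self i).symm⟩
    · exact .inl (.inr (isNegRoot_rootElt hij))
  · rw [eq_sum_lowElt h2 hw]
    exact sum_mem fun i _ => sum_mem fun j _ =>
      Submodule.smul_mem _ _ (Submodule.subset_span (.inl (.inr (isNegRoot_lowElt i j))))

theorem span_homogeneous_eq_top : Submodule.span F {x : pn n F | ∃ i, HasParity i x} = ⊤ := by
  refine eq_top_iff.2 fun x _ => ?_
  obtain ⟨y, z, w, hy, hz, hw, rfl⟩ := exists_degree_decomposition x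
  exact add_mem (add_mem (Submodule.subset_span ⟨0, hy⟩) (Submodule.subset_span ⟨1, hz.hasParity⟩))
    (Submodule.subset_span ⟨1, degNeg_parity hw⟩)

end RootVectors

section TriangularDecomposition

variable {F : Type*} [Field F] {p : ℕ} [Fact p.Prime] [CharP F p] {n : ℕ}

theorem ι_mul_ι {i j : ZMod 2} {x y : pn n F} (hx : HasParity i x) (hy : HasParity j y) :
    ι F p n x * ι F p n y = koszul F i j • (ι F p n y * ι F p n x) + ι F p n (bracket x y) := by
  rw [← ι_bracket hx hy, add_sub_cancel]

theorem cartanMap_ιh (x : Fin n → F) : cartanMap F p n (ιh F p n x) = ι F p n (cartanElt x) :=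
  liftUh_ιh p _ _ _ x

theorem ι_mem_leftIdealPos {x : pn n F} (hx : IsEvenPos x ∨ IsDegOne x) :
    ι F p n x ∈ leftIdealPos F n p :=
  Ideal.subset_span ⟨x, hx, rfl⟩

theorem ι_mul_ι_cartanElt_mem {x : pn n F} (hx : IsEvenPos x ∨ IsDegOne x) (h : Fin n → F) :
    ι F p n x * ι F p n (cartanElt h) ∈ leftIdealPos F n p := by
  have hpos : ∃ i, HasParity i x ∧
      (IsEvenPos (bracket x (cartanElt h)) ∨ IsDegOne (bracket x (cartanElt h))) := by
    rcases hx with hx | hx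
    · refine ⟨0, hx.1, .inl ?_⟩
      rw [eq_evenElt hx.1, cartanElt_eq, bracket_evenElt]
      refine ⟨evenElt_parity _, fun i j hij => ?_⟩
      rw [evenElt_coe, toBlocks_fromBlocks₁₁, Matrix.sub_apply, mul_diagonal, diagonal_mul,
        hx.2 i j hij, zero_mul, mul_zero, sub_zero]
    · exact ⟨1, hx.hasParity, .inr (bracket_degOne_even hx (cartanElt_parity h))⟩
  obtain ⟨i, hi, hbr⟩ := hpos
  rw [ι_mul_ι hi (cartanElt_parity h), koszul_zero_right, one_smul]
  exact add_mem (Ideal.mul_mem_left _ _ (ι_mem_leftIdealPos hx)) (ι_mem_leftIdealPos hbr)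

theorem mul_cartanMap_mem {u : Ubar F p n} (hu : u ∈ leftIdealPos F n p) (f : Uh F p n) :
    u * cartanMap F p n f ∈ leftIdealPos F n p := by
  induction show f ∈ Algebra.adjoin F (Set.range (ιh F p n)) from
      adjoin_range_ιh (F := F) ▸ Algebra.mem_top using Algebra.adjoin_induction generalizing u with
  | algebraMap r =>
    rw [AlgHom.commutes, ← Algebra.commutes]
    exact Ideal.mul_mem_left _ _ hu
  | mem f hf =>
    obtain ⟨h, rfl⟩ := hf
    rw [cartanMap_ιh]
    induction hu using Submodule.span_induction with
    | mem u hu =>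
      obtain ⟨x, hx, rfl⟩ := hu
      exact ι_mul_ι_cartanElt_mem hx h
    | zero => rw [zero_mul]; exact zero_mem _
    | add a b _ _ ha hb => rw [add_mul]; exact add_mem ha hb
    | smul a b _ hb => rw [smul_mul_assoc]; exact Submodule.smul_mem _ _ hb
  | mul a b _ _ ha hb => rw [map_mul, ← mul_assoc]; exact hb (ha hu)
  | add a b _ _ ha hb => rw [map_add, mul_add]; exact add_mem (ha hu) (hb hu)

variable (F p n) in
/-- The span of the products of negative root vectors and elements of u(𝔥), plus ū𝔫⁺. -/
def triangularSpan : Submodule F (Ubar F p n) :=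
  Submodule.span F {u | ∃ (l : List (pn n F)) (f : Uh F p n), (∀ y ∈ l, IsNegRoot F n y) ∧
    u = (l.map (ι F p n)).prod * cartanMap F p n f} ⊔ (leftIdealPos F n p).restrictScalars F

theorem prod_mul_cartanMap_mem {l : List (pn n F)} (hl : ∀ y ∈ l, IsNegRoot F n y)
    (f : Uh F p n) : (l.map (ι F p n)).prod * cartanMap F p n f ∈ triangularSpan F p n :=
  Submodule.mem_sup_left (Submodule.subset_span ⟨l, f, hl, rfl⟩)

theorem mul_mem_triangularSpan {a : Ubar F p n}
    (ha : ∀ (l : List (pn n F)) (f : Uh F p n), (∀ y ∈ l, IsNegRoot F n y) →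
      a * ((l.map (ι F p n)).prod * cartanMap F p n f) ∈ triangularSpan F p n)
    {u : Ubar F p n} (hu : u ∈ triangularSpan F p n) : a * u ∈ triangularSpan F p n := by
  suffices h : triangularSpan F p n ≤ (triangularSpan F p n).comap (LinearMap.mulLeft F a) from h hu
  refine sup_le (Submodule.span_le.2 ?_) fun u hu =>
    Submodule.mem_sup_right (Ideal.mul_mem_left _ _ hu)
  rintro _ ⟨l, f, hl, rfl⟩
  exact ha l f hl

theorem neg_mul_mem_triangularSpan {y : pn n F} (hy : IsNegRoot F n y) {u : Ubar F p n}
    (hu : u ∈ triangularSpan F p n) : ι F p n y * u ∈ triangularSpan F p n := by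
  refine mul_mem_triangularSpan (fun l f hl => ?_) hu
  rw [← mul_assoc, ← List.prod_cons, ← List.map_cons]
  exact prod_mul_cartanMap_mem (List.forall_mem_cons.2 ⟨hy, hl⟩) f

theorem ι_mul_cartanMap_mem (h2 : (2 : F) ≠ 0) (x : pn n F) (f : Uh F p n) :
    ι F p n x * cartanMap F p n f ∈ triangularSpan F p n := by
  suffices h : ⊤ ≤ (triangularSpan F p n).comap
      (LinearMap.mulRight F (cartanMap F p n f) ∘ₗ ι F p n) from h (x := x) trivial
  rw [← span_triangularSet_eq_top h2, Submodule.span_le]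
  rintro x ((hx | hx) | ⟨h, rfl⟩)
  · exact Submodule.mem_sup_right (mul_cartanMap_mem (ι_mem_leftIdealPos hx) f)
  · simpa using prod_mul_cartanMap_mem (l := [x]) (by simpa using hx) f
  · simpa [cartanMap_ιh] using prod_mul_cartanMap_mem (l := []) (by simp) (ιh F p n h * f)

theorem ι_mul_prod_mem (h2 : (2 : F) ≠ 0) {l : List (pn n F)} (hl : ∀ y ∈ l, IsNegRoot F n y)
    (f : Uh F p n) (x : pn n F) :
    ι F p n x * ((l.map (ι F p n)).prod * cartanMap F p n f) ∈ triangularSpan F p n := by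
  induction l generalizing x with
  | nil =>
    rw [List.map_nil, List.prod_nil, one_mul]
    exact ι_mul_cartanMap_mem h2 x f
  | cons y l ih =>
    obtain ⟨hy, hl⟩ := List.forall_mem_cons.1 hl
    obtain ⟨j, hj⟩ := hy.1
    suffices h : ⊤ ≤ (triangularSpan F p n).comap (LinearMap.mulRight F
        (((y :: l).map (ι F p n)).prod * cartanMap F p n f) ∘ₗ ι F p n) from h (x := x) trivial
    rw [← span_homogeneous_eq_top, Submodule.span_le]
    rintro x ⟨i, hx⟩
    rw [SetLike.mem_coe, Submodule.mem_comap, LinearMap.comp_apply, LinearMap.mulRight_apply,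
      List.map_cons, List.prod_cons, mul_assoc, ← mul_assoc, ι_mul_ι hx hj, add_mul,
      smul_mul_assoc, mul_assoc]
    exact add_mem (Submodule.smul_mem _ _ (neg_mul_mem_triangularSpan hy (ih hl x))) (ih hl _)

theorem triangularSpan_eq_top (h2 : (2 : F) ≠ 0) : triangularSpan F p n = ⊤ := by
  have key (u : Ubar F p n) : ∀ w ∈ triangularSpan F p n, u * w ∈ triangularSpan F p n := by
    induction show u ∈ Algebra.adjoin F (Set.range (ι F p n)) from
        adjoin_range_ι (F := F) ▸ Algebra.mem_top using Algebra.adjoin_induction with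
    | algebraMap r => exact fun w hw => by rw [← Algebra.smul_def]; exact Submodule.smul_mem _ _ hw
    | mem u hu =>
      obtain ⟨x, rfl⟩ := hu
      exact fun w => mul_mem_triangularSpan fun l f hl => ι_mul_prod_mem h2 hl f x
    | mul a b _ _ ha hb => exact fun w hw => by rw [mul_assoc]; exact ha _ (hb _ hw)
    | add a b _ _ ha hb => exact fun w hw => by rw [add_mul]; exact add_mem (ha _ hw) (hb _ hw)
  refine eq_top_iff.2 fun u _ => ?_
  have h1 : (1 : Ubar F p n) ∈ triangularSpan F p n := by
    simpa using prod_mul_cartanMap_mem (l := []) (by simp) (1 : Uh F p n)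
  simpa using key u 1 h1

end TriangularDecomposition

section TorusInvariants

variable {F : Type*} [Field F] {p : ℕ} [Fact p.Prime] [CharP F p] {n : ℕ}

theorem Ad_gradingTorus_pos (t : Fˣ) {x : pn n F} (hx : IsEvenPos x ∨ IsDegOne x) :
    IsEvenPos (Ad (gradingTorus n t) x) ∨ IsDegOne (Ad (gradingTorus n t) x) := by
  refine hx.imp (fun hx => ⟨Ad_parity _ hx.1, fun i j hij => ?_⟩) (Ad_degOne _)
  rw [Ad_blocks, toBlocks_fromBlocks₁₁, gradingTorus_coe, gradingTorus_inv_coe, mul_diagonal,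
    diagonal_mul, hx.2 i j hij, mul_zero, zero_mul]

theorem act_mem_leftIdealPos (t : Fˣ) {u : Ubar F p n} (hu : u ∈ leftIdealPos F n p) :
    act p (gradingTorus n t) u ∈ leftIdealPos F n p := by
  induction hu using Submodule.span_induction with
  | mem u hu =>
    obtain ⟨x, hx, rfl⟩ := hu
    rw [act_ι]
    exact ι_mem_leftIdealPos (Ad_gradingTorus_pos t hx)
  | zero => rw [map_zero]; exact zero_mem _
  | add a b _ _ ha hb => rw [map_add]; exact add_mem ha hb
  | smul a b _ hb => rw [smul_eq_mul, map_mul]; exact Ideal.mul_mem_left _ _ hb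

variable (F p n) in
/-- The action of the grading torus on ū/ū𝔫⁺. -/
def torusEnd (t : Fˣ) : Module.End F (Ubar F p n ⧸ (leftIdealPos F n p).restrictScalars F) :=
  Submodule.mapQ _ _ (act p (gradingTorus n t)).toLinearMap fun _ hu => act_mem_leftIdealPos t hu

theorem torusEnd_mkQ (t : Fˣ) (u : Ubar F p n) :
    torusEnd F p n t (Submodule.mkQ _ u) = Submodule.mkQ _ (act p (gradingTorus n t) u) := rfl

theorem mem_eigenspace_one_of_mem_torusInv (t : Fˣ) {u : Ubar F p n} (hu : u ∈ torusInv F n p) :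
    Submodule.mkQ _ u ∈ (torusEnd F p n t).eigenspace 1 := by
  rw [Module.End.mem_eigenspace_iff, torusEnd_mkQ, hu _ (gradingTorus_isDiag t), one_smul]

theorem exists_act_prod_eq {l : List (pn n F)} (hl : ∀ y ∈ l, IsNegRoot F n y) :
    ∃ r : ℕ, (l ≠ [] → 0 < r) ∧ ∀ t : Fˣ, act p (gradingTorus n t) (l.map (ι F p n)).prod =
      ((t ^ r : Fˣ) : F) • (l.map (ι F p n)).prod := by
  induction l with
  | nil => exact ⟨0, by simp, by simp⟩
  | cons y l ih =>
    obtain ⟨⟨-, q, hq, hy⟩, hl⟩ := List.forall_mem_cons.1 hl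
    obtain ⟨r, -, hr⟩ := ih hl
    refine ⟨q + r, fun _ => by omega, fun t => ?_⟩
    rw [List.map_cons, List.prod_cons, map_mul, hr, act_ι, hy, map_smul, smul_mul_smul_comm,
      pow_add, Units.val_mul]

theorem exists_mkQ_sub_cartanMap_mem (h2 : (2 : F) ≠ 0) (u : Ubar F p n) :
    ∃ (f : Uh F p n) (R : ℕ), 0 < R ∧ ∀ t : Fˣ, t ^ R ≠ 1 →
      Submodule.mkQ _ (u - cartanMap F p n f) ∈ ⨆ μ ≠ 1, (torusEnd F p n t).eigenspace μ := by
  obtain ⟨w, hw, j, hj, rfl⟩ := Submodule.mem_sup.1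
    (triangularSpan_eq_top (p := p) (n := n) h2 ▸ Submodule.mem_top (x := u))
  have hj0 : Submodule.mkQ ((leftIdealPos F n p).restrictScalars F) j = 0 := by simpa using hj
  simp only [add_sub_right_comm, map_add, hj0, add_zero]
  clear hj hj0
  induction hw using Submodule.span_induction with
  | mem w h =>
    obtain ⟨l, f, hl, rfl⟩ := h
    obtain rfl | hne := eq_or_ne l []
    · exact ⟨f, 1, one_pos, by simp⟩
    obtain ⟨r, hr, hact⟩ := exists_act_prod_eq (p := p) hl
    refine ⟨0, r, hr hne, fun t ht => Submodule.mem_iSup_of_mem ((t ^ r : Fˣ) : F)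
      (Submodule.mem_iSup_of_mem (Units.val_eq_one.not.2 ht) ?_)⟩
    rw [Module.End.mem_eigenspace_iff, torusEnd_mkQ, map_zero, sub_zero, map_mul, hact,
      cartanMap_mem F p n f _ (gradingTorus_isDiag t), smul_mul_assoc, map_smul]
  | zero => exact ⟨0, 1, one_pos, by simp⟩
  | add w w' _ _ h h' =>
    obtain ⟨f, R, hR, h⟩ := h
    obtain ⟨f', R', hR', h'⟩ := h'
    refine ⟨f + f', R * R', Nat.mul_pos hR hR', fun t ht => ?_⟩
    rw [map_add, add_sub_add_comm, map_add]
    exact add_mem (h t fun hc => ht (by rw [pow_mul, hc, one_pow]))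
      (h' t fun hc => ht (by rw [mul_comm, pow_mul, hc, one_pow]))
  | smul r w _ h =>
    obtain ⟨f, R, hR, h⟩ := h
    refine ⟨r • f, R, hR, fun t ht => ?_⟩
    rw [map_smul, ← smul_sub, map_smul]
    exact Submodule.smul_mem _ _ (h t ht)

theorem exists_unit_pow_ne_one [Infinite F] {R : ℕ} (hR : 0 < R) : ∃ t : Fˣ, t ^ R ≠ 1 := by
  have : NeZero R := ⟨hR.ne'⟩
  have : Infinite Fˣ := unitsEquivNeZero.infinite_iff.2
    (Set.finite_singleton (0 : F)).infinite_compl.to_subtype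
  by_contra! h
  exact not_injective_infinite_finite (fun t : Fˣ => (⟨t, h t⟩ : rootsOfUnity R F))
    fun _ _ => congrArg Subtype.val

theorem exists_sub_cartanMap_mem [Infinite F] (h2 : (2 : F) ≠ 0) {u : Ubar F p n}
    (hu : u ∈ torusInv F n p) : ∃ f, u - cartanMap F p n f ∈ leftIdealPos F n p := by
  obtain ⟨f, R, hR, hf⟩ := exists_mkQ_sub_cartanMap_mem h2 u
  obtain ⟨t, ht⟩ := exists_unit_pow_ne_one (F := F) hR
  have h1 := mem_eigenspace_one_of_mem_torusInv t (sub_mem hu (cartanMap_mem F p n f))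
  have h0 := ((torusEnd F p n t).eigenspaces_iSupIndep 1).le_bot ⟨h1, hf t ht⟩
  exact ⟨f, (Submodule.Quotient.mk_eq_zero _).1 h0⟩

end TorusInvariants

section Transvections

variable {F : Type*} [Field F] {n : ℕ} {E : Matrix (Fin n) (Fin n) F}

theorem bracket_evenElt_coe (a : Matrix (Fin n) (Fin n) F) (x : pn n F) :
    (bracket (evenElt a) x : Mat n F) = (evenElt a : Mat n F) * x - (x : Mat n F) * evenElt a := by
  change superComm (evenElt a : Mat n F) (x : Mat n F) = _
  simp [superComm, oddPart, evenElt_coe]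

theorem bracket_evenElt_add (a : Matrix (Fin n) (Fin n) F) (x y : pn n F) :
    bracket (evenElt a) (x + y) = bracket (evenElt a) x + bracket (evenElt a) y := by
  ext1
  simp only [Submodule.coe_add, bracket_evenElt_coe, Matrix.mul_add, Matrix.add_mul,
    add_sub_add_comm]

/-- The transvection 1 + sE for a matrix E of square zero. -/
def transvectionElt (hE : E * E = 0) (s : F) : GL (Fin n) F where
  val := 1 + s • E
  inv := 1 - s • E
  val_inv := by simp [Matrix.mul_sub, Matrix.add_mul, hE]
  inv_val := by simp [Matrix.mul_add, Matrix.sub_mul, hE]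

theorem rho_transvectionElt (hE : E * E = 0) (s : F) :
    rho (transvectionElt hE s) = 1 + s • (evenElt E : Mat n F) := by
  change fromBlocks (1 + s • E) 0 0 (1 - s • E)ᵀ = _
  rw [evenElt_coe, fromBlocks_smul, ← fromBlocks_one, fromBlocks_add]
  congr 1 <;> simp [sub_eq_add_neg]

theorem rho_transvectionElt_inv (hE : E * E = 0) (s : F) :
    rho (transvectionElt hE s)⁻¹ = 1 - s • (evenElt E : Mat n F) := by
  have hinv : (transvectionElt hE s)⁻¹ = transvectionElt hE (-s) := by
    ext1
    change 1 - s • E = 1 + (-s) • E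
    rw [neg_smul, sub_eq_add_neg]
  rw [hinv, rho_transvectionElt, neg_smul, sub_eq_add_neg]

theorem Ad_transvectionElt_coe (hE : E * E = 0) (s : F) (x : pn n F) :
    (Ad (transvectionElt hE s) x : Mat n F) = x + s • (bracket (evenElt E) x : Mat n F)
      - (s * s) • ((evenElt E : Mat n F) * x * evenElt E) := by
  change rho (transvectionElt hE s) * (x : Mat n F) * rho (transvectionElt hE s)⁻¹ = _
  rw [rho_transvectionElt, rho_transvectionElt_inv, bracket_evenElt_coe]
  simp only [Matrix.add_mul, Matrix.mul_sub, Matrix.one_mul, Matrix.mul_one, Matrix.smul_mul,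
    Matrix.mul_smul, smul_sub, smul_smul, smul_add]
  abel

theorem exists_Ad_transvectionElt_eq (hE : E * E = 0) (x : pn n F) :
    ∃ q : pn n F, ∀ s : F,
      Ad (transvectionElt hE s) x = x + s • bracket (evenElt E) x + (s * s) • q := by
  refine ⟨Ad (transvectionElt hE 1) x - x - bracket (evenElt E) x, fun s => ?_⟩
  ext1
  simp only [Submodule.coe_add, Submodule.coe_sub, Submodule.coe_smul, Ad_transvectionElt_coe,
    one_smul, one_mul]
  module

end Transvections

section InvariantsCommute

variable {F : Type*} [Field F] {p : ℕ} [Fact p.Prime] [CharP F p] {n : ℕ}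

theorem ι_bracket_evenElt (a : Matrix (Fin n) (Fin n) F) (x : pn n F) :
    ι F p n (bracket (evenElt a) x) =
      ι F p n (evenElt a) * ι F p n x - ι F p n x * ι F p n (evenElt a) := by
  obtain ⟨y, z, w, hy, hz, hw, rfl⟩ := exists_degree_decomposition x
  have ha := evenElt_parity a
  rw [bracket_evenElt_add, bracket_evenElt_add, map_add, map_add, ← ι_bracket ha hy,
    ← ι_bracket ha hz.hasParity, ← ι_bracket ha (degNeg_parity hw)]
  simp only [koszul_zero_left, one_smul, map_add, mul_add, add_mul]
  abel

theorem act_transvectionElt {E : Matrix (Fin n) (Fin n) F} (hE : E * E = 0) (u : Ubar F p n) :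
    ∃ P : Polynomial (Ubar F p n), P.coeff 0 = u ∧
      P.coeff 1 = ι F p n (evenElt E) * u - u * ι F p n (evenElt E) ∧
      ∀ s : F, act p (transvectionElt hE s) u = P.eval (algebraMap F _ s) := by
  induction show u ∈ Algebra.adjoin F (Set.range (ι F p n)) from
      adjoin_range_ι (F := F) ▸ Algebra.mem_top using Algebra.adjoin_induction with
  | algebraMap r =>
    refine ⟨Polynomial.C (algebraMap F _ r), by simp, ?_, by simp⟩
    rw [← Algebra.commutes, sub_self, Polynomial.coeff_C_succ]
  | mem u hu =>
    obtain ⟨x, rfl⟩ := hu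
    obtain ⟨q, hq⟩ := exists_Ad_transvectionElt_eq hE x
    refine ⟨Polynomial.C (ι F p n x) + Polynomial.C (ι F p n (bracket (evenElt E) x)) * Polynomial.X
      + Polynomial.C (ι F p n q) * Polynomial.X ^ 2, by simp, ?_, fun s => ?_⟩
    · rw [← ι_bracket_evenElt]
      simp [Polynomial.coeff_X_pow, Polynomial.coeff_C]
    · rw [act_ι, hq, ← pow_two]
      simp only [map_add, map_smul, Polynomial.eval_add, Polynomial.eval_C, Polynomial.eval_C_mul,
        Polynomial.eval_X, Polynomial.eval_X_pow, ← map_pow, ← Algebra.commutes s,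
        ← Algebra.commutes (s ^ 2), ← Algebra.smul_def]
  | mul a b _ _ ha hb =>
    obtain ⟨P, hP0, hP1, hP⟩ := ha
    obtain ⟨Q, hQ0, hQ1, hQ⟩ := hb
    refine ⟨P * Q, by rw [Polynomial.mul_coeff_zero, hP0, hQ0], ?_, fun s => ?_⟩
    · rw [Polynomial.mul_coeff_one, hP0, hP1, hQ0, hQ1]
      noncomm_ring
    · rw [map_mul, hP, hQ]
      exact (Polynomial.eval₂_mul_noncomm _ _ fun k => (Algebra.commutes s _).symm).symm
  | add a b _ _ ha hb =>
    obtain ⟨P, hP0, hP1, hP⟩ := ha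
    obtain ⟨Q, hQ0, hQ1, hQ⟩ := hb
    refine ⟨P + Q, by rw [Polynomial.coeff_add, hP0, hQ0], ?_, fun s => ?_⟩
    · rw [Polynomial.coeff_add, hP1, hQ1]
      noncomm_ring
    · rw [map_add, hP, hQ, Polynomial.eval_add]

theorem coeff_one_eq_zero_of_eval_eq [Infinite F] {A : Type*} [Ring A] [Algebra F A]
    {P : Polynomial A} {z : A} (h : ∀ s : F, P.eval (algebraMap F A s) = z) : P.coeff 1 = 0 := by
  rw [← Module.forall_dual_apply_eq_zero_iff F]
  intro l
  let q : Polynomial F :=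
    ∑ k ∈ Finset.range (P.natDegree + 2), Polynomial.monomial k (l (P.coeff k))
  have hq : q = Polynomial.C (l z) := by
    refine Polynomial.funext fun s => ?_
    rw [Polynomial.eval_C, ← h s,
      Polynomial.eval_eq_sum_range' (show P.natDegree < P.natDegree + 2 by omega), map_sum,
      Polynomial.eval_finsetSum]
    refine Finset.sum_congr rfl fun k _ => ?_
    rw [Polynomial.eval_monomial, ← map_pow, ← Algebra.commutes, ← Algebra.smul_def, map_smul,
      smul_eq_mul, mul_comm]
  have h1 : q.coeff 1 = l (P.coeff 1) := by
    simp [q, Polynomial.finsetSum_coeff, Polynomial.coeff_monomial]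
  rw [← h1, hq, Polynomial.coeff_C_succ]

theorem commute_of_act_eq [Infinite F] {z : Ubar F p n} (hz : ∀ g : GL (Fin n) F, act p g z = z)
    {E : Matrix (Fin n) (Fin n) F} (hE : E * E = 0) : Commute (ι F p n (evenElt E)) z := by
  obtain ⟨P, -, h1, hP⟩ := act_transvectionElt hE z
  rw [commute_iff_eq, ← sub_eq_zero, ← h1]
  exact coeff_one_eq_zero_of_eval_eq fun s => by rw [← hP, hz]

end InvariantsCommute

section Reflection

variable {F : Type*} [Field F] {n : ℕ} {i j : Fin n}

theorem bracket_cartanElt_rootElt (x : Fin n → F) (i j : Fin n) :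
    bracket (cartanElt x) (rootElt F i j) = (x i - x j) • rootElt F i j := by
  rw [cartanElt_eq, rootElt, bracket_evenElt, ← map_smul]
  congr 1
  ext a b
  rw [Matrix.sub_apply, diagonal_mul, mul_diagonal, Matrix.smul_apply, single_apply]
  split_ifs with h
  · rw [← h.1, ← h.2, mul_one, one_mul, smul_eq_mul, mul_one]
  · simp

theorem bracket_rootElt_rootElt (i j : Fin n) :
    bracket (rootElt F i j) (rootElt F j i) = cartanElt (Pi.single i 1 - Pi.single j 1) := by
  rw [rootElt, rootElt, bracket_evenElt, cartanElt_eq, single_mul_single_same,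
    single_mul_single_same, mul_one, ← diagonal_single, ← diagonal_single, diagonal_sub]
  rfl

/-- The positive root vectors of p(n) without component along the root vector of εᵢ - εⱼ, which
span the nilradical of a parabolic subalgebra when that root is simple. -/
def IsPosAvoiding (i j : Fin n) (x : pn n F) : Prop :=
  (IsEvenPos x ∧ (x : Mat n F).toBlocks₁₁ i j = 0) ∨ IsDegOne x

/-- Subtracting a simple root from another positive root never leaves the positive roots. -/
theorem commutator_single_apply_eq_zero (hij : i ⋖ j) {A : Matrix (Fin n) (Fin n) F}
    (hA : ∀ r c, c ≤ r → A r c = 0) (h0 : A i j = 0) {r c : Fin n} (hrc : c ≤ r ∨ c = j) :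
    (A * Matrix.single j i (1 : F) - Matrix.single j i (1 : F) * A) r c = 0 := by
  have hleft : (A * Matrix.single j i (1 : F)) r c = 0 := by
    obtain rfl | hc := eq_or_ne c i
    · rw [mul_single_apply_same, mul_one]
      obtain rfl | hr := eq_or_ne r c
      · exact h0
      · have hcr : c < r := (hrc.resolve_right hij.lt.ne).lt_of_ne' hr
        exact hA _ _ (not_lt.1 (hij.2 hcr))
    · exact mul_single_apply_of_ne _ _ _ _ _ hc _
  have hright : (Matrix.single j i (1 : F) * A) r c = 0 := by
    obtain rfl | hr := eq_or_ne r j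
    · rw [single_mul_apply_same, one_mul]
      obtain rfl | hc := eq_or_ne c r
      · exact h0
      · have hcr : c < r := (hrc.resolve_right hc).lt_of_ne hc
        exact hA _ _ (not_lt.1 fun h => hij.2 h hcr)
    · exact single_mul_apply_of_ne _ _ _ _ _ hr _
  rw [Matrix.sub_apply, hleft, hright, sub_zero]

theorem IsPosAvoiding.bracket_rootElt (hij : i ⋖ j) {x : pn n F} (hx : IsPosAvoiding i j x) :
    IsPosAvoiding i j (bracket x (rootElt F j i)) := by
  refine hx.imp (fun ⟨hx, h0⟩ => ?_) fun hx => bracket_degOne_even hx (rootElt_parity j i)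
  rw [eq_evenElt hx.1, rootElt, bracket_evenElt]
  refine ⟨⟨evenElt_parity _, fun r c hcr => ?_⟩, ?_⟩ <;> rw [evenElt_coe, toBlocks_fromBlocks₁₁]
  · exact commutator_single_apply_eq_zero hij hx.2 h0 (.inl hcr)
  · exact commutator_single_apply_eq_zero hij hx.2 h0 (.inr rfl)

theorem exists_eq_add_smul_rootElt (hij : i < j) {x : pn n F} (hx : IsEvenPos x ∨ IsDegOne x) :
    ∃ (y : pn n F) (c : F), IsPosAvoiding i j y ∧ x = y + c • rootElt F i j := by
  obtain hx | hx := hx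
  · refine ⟨evenElt ((x : Mat n F).toBlocks₁₁ - Matrix.single i j ((x : Mat n F).toBlocks₁₁ i j)),
      (x : Mat n F).toBlocks₁₁ i j, .inl ⟨⟨evenElt_parity _, fun r s hrs => ?_⟩, ?_⟩, ?_⟩
    · rw [evenElt_coe, toBlocks_fromBlocks₁₁, Matrix.sub_apply, hx.2 r s hrs, zero_sub,
        single_apply_of_ne, neg_zero]
      rintro ⟨rfl, rfl⟩
      exact hrs.not_gt hij
    · rw [evenElt_coe, toBlocks_fromBlocks₁₁, Matrix.sub_apply, single_apply_same, sub_self]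
    · rw [rootElt, ← map_smul, smul_single, smul_eq_mul, mul_one, ← map_add, sub_add_cancel]
      exact eq_evenElt hx.1
  · exact ⟨x, 0, .inr hx, by rw [zero_smul, add_zero]⟩

variable {p : ℕ} [Fact p.Prime] [CharP F p] {R : Type*} [AddCommGroup R] [Module F R]
  {φ : pn n F →ₗ[F] Module.End F R} {lam : Fin n → ZMod p} {v : R}

theorem IsSingular.cartanElt_rootElt_pow (hφ : IsRep p φ) (hv : IsSingular φ lam v)
    (i j : Fin n) (x : Fin n → F) (k : ℕ) :
    φ (cartanElt x) ((φ (rootElt F i j) ^ k) v) =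
      (∑ l, x l * weightCast F lam l + k * (x i - x j)) • (φ (rootElt F i j) ^ k) v := by
  induction k with
  | zero => simp [hv.weight]
  | succ k ih =>
    rw [pow_succ', Module.End.mul_apply, hφ.swap (cartanElt_parity x) (rootElt_parity i j), ih,
      bracket_cartanElt_rootElt, koszul_zero_right, one_smul, map_smul, map_smul,
      LinearMap.smul_apply, ← add_smul]
    congr 1
    push_cast
    ring

theorem IsSingular.posAvoiding_rootElt_pow (hφ : IsRep p φ) (hv : IsSingular φ lam v)
    (hij : i ⋖ j) (k : ℕ) {x : pn n F} (hx : IsPosAvoiding i j x) :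
    φ x ((φ (rootElt F j i) ^ k) v) = 0 := by
  induction k generalizing x with
  | zero => exact hv.pos x (hx.imp_left And.left)
  | succ k ih =>
    obtain ⟨q, hq⟩ : ∃ q, HasParity q x :=
      hx.elim (fun hx => ⟨0, hx.1.1⟩) fun hx => ⟨1, hx.hasParity⟩
    rw [pow_succ', Module.End.mul_apply, hφ.swap hq (rootElt_parity j i), ih hx,
      ih (hx.bracket_rootElt hij), map_zero, smul_zero, add_zero]

theorem IsSingular.rootElt_rootElt_pow (hφ : IsRep p φ) (hv : IsSingular φ lam v) (hij : i < j)
    (k : ℕ) : φ (rootElt F i j) ((φ (rootElt F j i) ^ (k + 1)) v) =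
      ((k + 1) * (weightCast F lam i - weightCast F lam j - k)) •
        (φ (rootElt F j i) ^ k) v := by
  have hweight : ∑ l, (Pi.single i 1 - Pi.single j 1 : Fin n → F) l * weightCast F lam l =
      weightCast F lam i - weightCast F lam j := by
    simp [sub_mul, Finset.sum_sub_distrib, Pi.single_apply]
  have step (k : ℕ) : φ (rootElt F i j) ((φ (rootElt F j i) ^ (k + 1)) v) =
      φ (rootElt F j i) (φ (rootElt F i j) ((φ (rootElt F j i) ^ k) v)) +
      (weightCast F lam i - weightCast F lam j - 2 * (k : F)) • (φ (rootElt F j i) ^ k) v := by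
    rw [pow_succ', Module.End.mul_apply, hφ.swap (rootElt_parity i j) (rootElt_parity j i),
      koszul_zero_right, one_smul, bracket_rootElt_rootElt, hv.cartanElt_rootElt_pow hφ, hweight]
    simp only [Pi.sub_apply, Pi.single_eq_same, Pi.single_eq_of_ne hij.ne,
      Pi.single_eq_of_ne hij.ne']
    congr 2
    ring
  induction k with
  | zero =>
    rw [step, pow_zero, Module.End.one_apply, hv.pos _ (.inl (isEvenPos_rootElt hij)), map_zero]
    simp
  | succ k ih =>
    rw [step, ih, map_smul, ← Module.End.mul_apply, ← pow_succ', ← add_smul]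
    congr 1
    push_cast
    ring

theorem dotWeight_swap (hij : i ⋖ j) {μ : Fin n → F} {c : F} (hc : c = μ i - μ j + 1) :
    dotWeight (Equiv.swap i j) μ = μ + c • (Pi.single j 1 - Pi.single i 1) := by
  have hρ : ((j : ℕ) : F) = (i : ℕ) + 1 := by
    rw [← Nat.covBy_iff_add_one_eq.1 (Fin.covBy_iff.1 hij), Nat.cast_add_one]
  ext l
  rw [hc]
  rcases eq_or_ne l i with rfl | hi
  · simp [dotWeight, rhoWeight, hij.lt.ne, hρ]
    ring
  · rcases eq_or_ne l j with rfl | hj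
    · simp [dotWeight, rhoWeight, hij.lt.ne', hρ]
      ring
    · simp [dotWeight, Equiv.swap_apply_of_ne_of_ne hi hj, hi, hj]

theorem natCast_eq_weightCast {k : ℕ} (hk : (k : ZMod p) = lam i - lam j + 1) :
    (k : F) = weightCast F lam i - weightCast F lam j + 1 := by
  simpa only [map_natCast, map_add, map_sub, map_one, weightCast] using
    congrArg (ZMod.castHom (dvd_refl p) F) hk

theorem IsSingular.reflect (hφ : IsRep p φ) (hv : IsSingular φ lam v) (hij : i ⋖ j) {k : ℕ}
    (hk : (k : ZMod p) = lam i - lam j + 1) (hne : (φ (rootElt F j i) ^ k) v ≠ 0) :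
    IsSingular φ (dotWeight (Equiv.swap i j) lam) ((φ (rootElt F j i) ^ k) v) where
  ne_zero := hne
  pos x hx := by
    have hk' := natCast_eq_weightCast (F := F) hk
    have hroot : φ (rootElt F i j) ((φ (rootElt F j i) ^ k) v) = 0 := by
      rcases k with _ | k
      · exact hv.pos _ (.inl (isEvenPos_rootElt hij.lt))
      · rw [hv.rootElt_rootElt_pow hφ hij.lt,
          show weightCast F lam i - weightCast F lam j - (k : F) = 0 by
            push_cast at hk'
            linear_combination -hk', mul_zero, zero_smul]
    obtain ⟨y, c, hy, rfl⟩ := exists_eq_add_smul_rootElt hij.lt hx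
    rw [map_add, LinearMap.add_apply, map_smul, LinearMap.smul_apply, hroot, smul_zero,
      hv.posAvoiding_rootElt_pow hφ hij k hy, add_zero]
  weight x := by
    rw [hv.cartanElt_rootElt_pow hφ, weightCast_dotWeight,
      dotWeight_swap hij (natCast_eq_weightCast hk)]
    congr 1
    simp [mul_add, Finset.sum_add_distrib, mul_sub, Finset.sum_sub_distrib, Pi.single_apply]
    ring

end Reflection

section HarishChandra

variable {F : Type*} [Field F] {p : ℕ} [Fact p.Prime] [CharP F p] {n : ℕ}

theorem isRep_ι_comp {A : Type*} [Ring A] [Algebra F A] (Φ : Ubar F p n →ₐ[F] A) :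
    IsRep p (Φ.toLinearMap ∘ₗ ι F p n) where
  bracket i j x y hx hy := by
    have h := congrArg Φ (ι_bracket (p := p) hx hy)
    rwa [map_sub, map_smul, map_mul, map_mul] at h
  pPower x hx := by
    have h := congrArg (Φ.comp (toUbar F p n)) (ιU_pPower (p := p) hx)
    rwa [map_pow] at h

section Singular

variable {V : Type*} [AddCommGroup V] [Module F V] {Φ : Ubar F p n →ₐ[F] Module.End F V}
  {lam : Fin n → ZMod p} {v : V}

theorem IsSingular.apply_of_mem (hv : IsSingular (fun x => Φ (ι F p n x)) lam v) {u : Ubar F p n}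
    (hu : u ∈ leftIdealPos F n p) : Φ u v = 0 := by
  induction hu using Submodule.span_induction with
  | mem u hu =>
    obtain ⟨x, hx, rfl⟩ := hu
    exact hv.pos x hx
  | zero => rw [map_zero, LinearMap.zero_apply]
  | add a b _ _ ha hb => rw [map_add, LinearMap.add_apply, ha, hb, add_zero]
  | smul a b _ hb => rw [smul_eq_mul, map_mul, Module.End.mul_apply, hb, map_zero]

theorem IsSingular.apply_cartanMap (hv : IsSingular (fun x => Φ (ι F p n x)) lam v)
    (f : Uh F p n) : Φ (cartanMap F p n f) v = ev F lam f • v := by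
  induction show f ∈ Algebra.adjoin F (Set.range (ιh F p n)) from
      adjoin_range_ιh (F := F) ▸ Algebra.mem_top using Algebra.adjoin_induction with
  | algebraMap r =>
    rw [AlgHom.commutes, AlgHom.commutes, AlgHom.commutes, Module.algebraMap_end_apply,
      Algebra.algebraMap_self_apply]
  | mem f hf =>
    obtain ⟨x, rfl⟩ := hf
    rw [cartanMap_ιh, ev_ιh]
    exact hv.weight x
  | mul a b _ _ ha hb =>
    rw [map_mul, map_mul, Module.End.mul_apply, hb, map_smul, ha, smul_smul, map_mul, mul_comm]
  | add a b _ _ ha hb =>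
    rw [map_add, map_add, LinearMap.add_apply, ha, hb, map_add, add_smul]

theorem IsHarishChandra.apply_singular {h : torusInv F n p →ₗ[F] Uh F p n}
    (hh : IsHarishChandra F p n h) (hv : IsSingular (fun x => Φ (ι F p n x)) lam v)
    (u : torusInv F n p) : Φ u v = ev F lam (h u) • v := by
  have hker : u - ⟨cartanMap F p n (h u), cartanMap_mem F p n (h u)⟩ ∈ lSub F n p := by
    rw [← hh.2, LinearMap.mem_ker, map_sub, hh.1, sub_self]
  rw [← hv.apply_cartanMap, ← sub_eq_zero, ← LinearMap.sub_apply, ← map_sub]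
  exact hv.apply_of_mem hker

end Singular

theorem eq_zero_of_cartanMap_mem (h2 : (2 : F) ≠ 0) {f : Uh F p n}
    (hf : cartanMap F p n f ∈ leftIdealPos F n p) : f = 0 := by
  refine eq_zero_of_ev_eq_zero fun lam => ?_
  obtain ⟨R, _, _, φ, v, hφ, hv⟩ := hasSingular F lam
  obtain ⟨V, Φ, v', hv', -⟩ := hv.exists_ubar h2 hφ
  have heigen := hv'.apply_cartanMap f
  rw [hv'.apply_of_mem hf, eq_comm, smul_eq_zero] at heigen
  exact heigen.resolve_right hv'.ne_zero

/-- The canonical map from u(𝔥) to ūᵀ, which the Harish-Chandra map splits. -/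
def cartanMapInv (F : Type*) [Field F] (p : ℕ) [Fact p.Prime] [CharP F p] (n : ℕ) :
    Uh F p n →ₗ[F] torusInv F n p :=
  (cartanMap F p n).toLinearMap.codRestrict _ (cartanMap_mem F p n)

theorem cartanMapInv_injective (h2 : (2 : F) ≠ 0) : Function.Injective (cartanMapInv F p n) := by
  refine (injective_iff_map_eq_zero _).2 fun f hf => eq_zero_of_cartanMap_mem h2 ?_
  rw [show cartanMap F p n f = 0 from congrArg Subtype.val hf]
  exact zero_mem _

theorem isCompl_range_cartanMapInv [Infinite F] (h2 : (2 : F) ≠ 0) :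
    IsCompl (LinearMap.range (cartanMapInv F p n)) (lSub F n p) := by
  constructor
  · rw [Submodule.disjoint_def]
    rintro _ ⟨f, rfl⟩ hf
    rw [eq_zero_of_cartanMap_mem h2 hf, map_zero]
  · refine Submodule.codisjoint_iff_exists_add_eq.2 fun u => ?_
    obtain ⟨f, hf⟩ := exists_sub_cartanMap_mem h2 u.2
    exact ⟨cartanMapInv F p n f, u - cartanMapInv F p n f, ⟨f, rfl⟩, hf, add_sub_cancel _ _⟩

theorem existsUnique_isHarishChandra [Infinite F] (h2 : (2 : F) ≠ 0) :
    ∃! h : torusInv F n p →ₗ[F] Uh F p n, IsHarishChandra F p n h := by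
  have hinj := cartanMapInv_injective (F := F) (p := p) (n := n) h2
  have hcompl := isCompl_range_cartanMapInv (F := F) (p := p) (n := n) h2
  refine ⟨LinearMap.linearProjOfIsCompl _ _ hinj hcompl,
    ⟨LinearMap.linearProjOfIsCompl_apply_left _ _ hinj hcompl,
      LinearMap.ker_linearProjOfIsCompl _ _ hinj hcompl⟩, fun h hh => LinearMap.ext fun u => ?_⟩
  obtain ⟨_, l, ⟨f, rfl⟩, hl, rfl⟩ := Submodule.codisjoint_iff_exists_add_eq.1 hcompl.codisjoint u
  have hl0 : h l = 0 := by rwa [← LinearMap.mem_ker, hh.2]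
  have hf : h (cartanMapInv F p n f) = f := hh.1 f
  rw [map_add, map_add, LinearMap.linearProjOfIsCompl_apply_left,
    LinearMap.linearProjOfIsCompl_apply_right' _ _ hinj hcompl l hl, hl0, hf]

theorem IsHarishChandra.apply_mem_dotInv [Infinite F] (h2 : (2 : F) ≠ 0)
    {h : torusInv F n p →ₗ[F] Uh F p n} (hh : IsHarishChandra F p n h) {z : torusInv F n p}
    (hz : ∀ g : GL (Fin n) F, act p g (z : Ubar F p n) = z) : h z ∈ dotInv F p n := by
  refine mem_dotInv_of_simple fun i j hij lam => ?_
  obtain ⟨R, _, _, φ, v₀, hφ, hv₀, hne₀⟩ := exists_isSingular_rootElt_pow_ne_zero F lam hij.lt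
  obtain ⟨V, Φ, v, hv, hpow⟩ := hv₀.exists_ubar h2 hφ
  let f := Φ (ι F p n (rootElt F j i))
  let k := (lam i - lam j + 1).val
  have hne : (f ^ k) v ≠ 0 := fun h0 =>
    hne₀ k (ZMod.val_lt _) (by rw [← hpow, h0, Submodule.coe_zero])
  have hreflect : IsSingular (fun x => Φ (ι F p n x)) (dotWeight (Equiv.swap i j) lam)
      ((f ^ k) v) :=
    IsSingular.reflect (isRep_ι_comp Φ) hv hij (ZMod.natCast_zmod_val _) hne
  have hcomm : Commute (Φ z) f :=
    ((commute_of_act_eq hz (single_mul_single_of_ne _ _ _ _ hij.lt.ne _)).map Φ).symm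
  have hscalars : ev F (dotWeight (Equiv.swap i j) lam) (h z) • (f ^ k) v =
      ev F lam (h z) • (f ^ k) v := by
    rw [← hh.apply_singular hreflect, ← map_smul, ← hh.apply_singular hv,
      ← Module.End.mul_apply, ← Module.End.mul_apply, (hcomm.pow_right k).eq]
  exact smul_left_injective F hne hscalars

end HarishChandra

end Periplectic

end

theorem lemma3p7_general (F : Type*) [Field F] [Infinite F] (p : ℕ) [Fact p.Prime] [CharP F p]
    (hp : p ≠ 2) (n : ℕ) :
    (∃! h : Periplectic.torusInv F n p →ₗ[F] Periplectic.Uh F p n,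
      Periplectic.IsHarishChandra F p n h) ∧
    ∀ h : Periplectic.torusInv F n p →ₗ[F] Periplectic.Uh F p n,
      Periplectic.IsHarishChandra F p n h →
      ∀ z : Periplectic.torusInv F n p,
        (∀ g : GL (Fin n) F, Periplectic.act p g (z : Periplectic.Ubar F p n) = z) →
          h z ∈ Periplectic.dotInv F p n := by
  have h2 : (2 : F) ≠ 0 := Ring.two_ne_zero ((ringChar.eq F p).symm ▸ hp)
  exact ⟨Periplectic.existsUnique_isHarishChandra h2, fun _ hh _ => hh.apply_mem_dotInv h2⟩

theorem lemma3p7 (F : Type*) [Field F] [IsAlgClosed F] (p : ℕ) [Fact p.Prime] [CharP F p]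
    (hp : 3 < p) (n : ℕ) (hn : 2 ≤ n) :
    (∃! h : Periplectic.torusInv F n p →ₗ[F] Periplectic.Uh F p n,
      Periplectic.IsHarishChandra F p n h) ∧
    ∀ h : Periplectic.torusInv F n p →ₗ[F] Periplectic.Uh F p n,
      Periplectic.IsHarishChandra F p n h →
      h '' {z | (z : Periplectic.Ubar F p n) ∈ Periplectic.centralZ F n p}
        ⊆ Periplectic.dotInv F p n := by
  have := IsAlgClosed.instInfinite (K := F)
  obtain ⟨hex, hinv⟩ := lemma3p7_general F p (by lia) n
  exact ⟨hex, fun h hh => Set.image_subset_iff.2 fun z hz => hinv h hh z hz.2.1⟩
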